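/- \textbf{Model.} A corridor $[0,l]$, $l>0$, has a fundamental diagram $Q:[0,k_j]\to\mathbb R$, $k_j>0$, concave and continuous with $Q(0)=Q(k_j)=0$, and capacity $q_c=\max Q$. A bottleneck occupies $[x_0,l]$, $0\le x_0\le l$, with non-increasing capacity $q_{bn}(x)$, $q_{bn}(x_0)=q_c$ (a drop only at $x=l$, i.e. a point bottleneck at the downstream end, is allowed); put $q_{bn}(x)=q_c$ for $x<x_0$. The local flow-density relation is $Q(x,k)=\min\{Q(k),q_{bn}(x)\}$. The upstream flow is $$g(t)=\begin{cases}q_b+at,&0\le t\le \frac{q_p-q_b}{a},\\ q_p,&\frac{q_p-q_b}{a}\le t\le t_{\mathrm{off}},\\ q_p-b(t-t_{\mathrm{off}}),&t_{\mathrm{off}}\le t\le t_{\mathrm{off}}+\frac{q_p-q_e}{b},\\ q_e,&t\ge t_{\mathrm{off}}+\frac{q_p-q_e}{b},\end{cases}$$ with $a,b>0$, $0\le q_b<q_p\le q_c$, $0\le q_e<q_p$, $q_b<q_{bn}(l)$ and $t_{\mathrm{off}}\ge (q_p-q_b)/a$. Initially the link is uncongested with uniform flow $q_b$, i.e. with density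 $k_b=\min\{k:Q(k)=q_b\}$. Let $N(x,t)$ be the cumulative flow of the LWR model, i.e. of the entropy solution of $k_t+Q(x,k)_x=0$, $k=-N_x$, $q=N_t$, in variational (Lax--Hopf) form: $$N(x,t)=\inf_{\xi}\Big\{B(s,\xi(s))+\int_s^t R(\xi(r),\dot\xi(r))\,dr\Big\},\qquad R(x,u)=\sup_{0\le k\le k_j}\{Q(x,k)-uk\},$$ over all Lipschitz paths $\xi:[s,t]\to[0,l]$, $0\le s\le t$, with $\xi(t)=x$ which start at $s=0$, where $B(0,y)=-k_b y$, or at $\xi(s)=0$, where $B(s,0)=\int_0^s g$. (A queue may reach $x=0$; then it limits the inflow and the remaining vehicles wait upstream.) The accumulation is $A(t)=N(0,t)-N(l,t)$, and the network exit flow $P(t)$ is the right-hand derivative of $N(l,\cdot)$ at $t$. A queue is called active at time $t$ if $N(l,t)$ is smaller than the corresponding value for the same corridor without bottleneck ($q_{bn}\equiv q_c$). Let $S=\{t\ge0: P(t)=q_{bn}(l)\}$. \textbf{Proposition.} The curve of $A(t)$ (horizontal) against $P(t)$ (vertical) is a counter-clockwise hysteresis loop, in the following sense. \begin{enumerate}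 \item $P(t)$ exists and $P(t)\le q_{bn}(l)$ for all $t\ge0$. \item If $0\le t_1<t_2$ and $A(t_1)=A(t_2)$, then $P(t_1)\le P(t_2)$. If moreover $t_1>0$, then $P(t_1)<P(t_2)$ or $P$ is constant on $[t_1,t_2]$. \item $P(t)=q_{bn}(l)$ whenever a queue is active at time $t \geq 0$, and $S$ is an interval (possibly empty). \item Suppose $q_e<q_{bn}(l)$. Then there is $t_{\max}\ge0$ such that $A$ is non-decreasing on $[0,t_{\max}]$ and non-increasing on $[t_{\max},\infty)$. The set $S$ is bounded, and if it has more than one point, then $A(\sup S)<A(\inf S)$: the same exit flow occurs with fewer vehicles at the end of the saturated period than at its beginning. If at some time $t\geq 0$ both $A(t)>A(0)$ and $P(t)>P(0)$, then there are $0\le t_1<t_2$ with $A(t_1)=A(t_2)$ and $P(t_1)<P(t_2)$. \end{enumerate} -/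

import Mathlib

open Set MeasureTheory

noncomputable section

/-- Data of a traffic corridor: the link `[0, length]`, the fundamental diagram `Q` (flow as a
function of density on `[0, jam]`), and a continuous bottleneck with capacity `qbn x` for
`x0 ≤ x ≤ length`. -/
structure Corridor where
  length : ℝ
  x0 : ℝ
  jam : ℝ
  Q : ℝ → ℝ
  qbn : ℝ → ℝ

namespace Corridor

/-- Capacity of the link according to its fundamental diagram. -/
def capacity (C : Corridor) : ℝ := sSup (C.Q '' Icc 0 C.jam)

/-- Standing assumptions on the corridor. A drop of `qbn` at `x = length` only (a point bottleneck
at the downstream end) is allowed. -/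
structure IsValid (C : Corridor) : Prop where
  length_pos : 0 < C.length
  x0_mem : C.x0 ∈ Icc 0 C.length
  jam_pos : 0 < C.jam
  concave : ConcaveOn ℝ (Icc 0 C.jam) C.Q
  continuous : ContinuousOn C.Q (Icc 0 C.jam)
  Q_zero : C.Q 0 = 0
  Q_jam : C.Q C.jam = 0
  qbn_antitone : AntitoneOn C.qbn (Icc C.x0 C.length)
  qbn_start : C.qbn C.x0 = C.capacity

/-- Capacity at position `x`. -/
def localCapacity (C : Corridor) (x : ℝ) : ℝ := if x < C.x0 then C.capacity else C.qbn x

/-- Location-dependent fundamental diagram: that of the link, cut off at the local capacity. -/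
def localQ (C : Corridor) (x k : ℝ) : ℝ := min (C.Q k) (C.localCapacity x)

/-- Capacity of the bottleneck at the downstream end. -/
def exitCapacity (C : Corridor) : ℝ := C.localCapacity C.length

/-- Density of uncongested traffic with flow `q`. -/
def freeDensity (C : Corridor) (q : ℝ) : ℝ := sInf {k | k ∈ Icc 0 C.jam ∧ C.Q k = q}

/-- The largest rate at which vehicles can overtake an observer who is at `x` and moves with
velocity `u`: the supremum of `localQ x k - u * k` over all densities (Legendre transform). -/
def passingRate (C : Corridor) (x u : ℝ) : ℝ :=
  sSup ((fun k => C.localQ x k - u * k) '' Icc 0 C.jam)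

end Corridor

/-- Parameters of the trapezoidal upstream flow: initial flow, peak flow, end flow, rate of
increase, rate of decrease, and the time at which the decrease begins. -/
structure RushHour where
  qb : ℝ
  qp : ℝ
  qe : ℝ
  a : ℝ
  b : ℝ
  toff : ℝ

namespace RushHour

/-- The trapezoidal, piecewise linear upstream boundary flow. -/
def flow (D : RushHour) (t : ℝ) : ℝ :=
  if t ≤ (D.qp - D.qb) / D.a then D.qb + D.a * t
  else if t ≤ D.toff then D.qp
  else if t ≤ D.toff + (D.qp - D.qe) / D.b then D.qp - D.b * (t - D.toff)
  else D.qe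

/-- Number of vehicles that want to enter during `[0, t]`. -/
def cumulative (D : RushHour) (t : ℝ) : ℝ := ∫ r in (0 : ℝ)..t, D.flow r

/-- Admissible rush hours on a corridor: the flow rises from `qb` to `qp` and falls to `qe`,
the peak can be carried by the link, and the bottleneck is not active initially. -/
structure IsValid (D : RushHour) (C : Corridor) : Prop where
  a_pos : 0 < D.a
  b_pos : 0 < D.b
  qb_nonneg : 0 ≤ D.qb
  qe_nonneg : 0 ≤ D.qe
  qb_lt_qp : D.qb < D.qp
  qe_lt_qp : D.qe < D.qp
  peak_le_toff : (D.qp - D.qb) / D.a ≤ D.toff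
  qp_le_capacity : D.qp ≤ C.capacity
  qb_lt_exit : D.qb < C.exitCapacity

end RushHour

namespace Corridor

/-- `ξ` is (on `[s, t]`) a Lipschitz observer path inside the corridor which ends at `x`. -/
def IsPath (C : Corridor) (ξ : ℝ → ℝ) (s t x : ℝ) : Prop :=
  (∃ K : NNReal, LipschitzWith K ξ) ∧ (∀ r ∈ Icc s t, ξ r ∈ Icc 0 C.length) ∧ ξ t = x

/-- The largest number of vehicles that can overtake an observer with path `ξ` during `[s, t]`. -/
def pathCost (C : Corridor) (ξ : ℝ → ℝ) (s t : ℝ) : ℝ :=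
  ∫ r in s..t, C.passingRate (ξ r) (deriv ξ r)

/-- Cumulative flow `N(x, t)` of the LWR model, i.e. of the entropy solution of
`k_t + (localQ x k)_x = 0` with `k = -N_x`, `q = N_t`, in variational (Lax-Hopf) form: `N(x, t)` is
the least value obtained by adding, along any path from the space-time boundary to `(x, t)`, the
path cost to the boundary value. The initial state is uncongested with constant flow `qb`, so that
`N(y, 0) = -y * freeDensity qb`; at `x = 0` not more than the demand may have entered. As long as
a queue covers `x = 0`, the inflow is limited by this queue and the remaining vehicles wait
upstream. -/
def cumulativeFlow (C : Corridor) (D : RushHour) (x t : ℝ) : ℝ :=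
  sInf {n | ∃ (s : ℝ) (ξ : ℝ → ℝ), 0 ≤ s ∧ s ≤ t ∧ C.IsPath ξ s t x ∧
    ((s = 0 ∧ n = -(C.freeDensity D.qb * ξ 0) + C.pathCost ξ 0 t) ∨
      (ξ s = 0 ∧ n = D.cumulative s + C.pathCost ξ s t))}

/-- Accumulation: the number `∫ k dx` of vehicles on the link; recall `k = -∂N/∂x`. -/
def accumulation (C : Corridor) (D : RushHour) (t : ℝ) : ℝ :=
  C.cumulativeFlow D 0 t - C.cumulativeFlow D C.length t

/-- Network exit flow: the flow `∂N/∂t` at the downstream end. It jumps down when a shock arrives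
there; the value immediately after `t` is taken. -/
def exitFlow (C : Corridor) (D : RushHour) (t : ℝ) : ℝ :=
  derivWithin (fun r => C.cumulativeFlow D C.length r) (Ici t) t

/-- The same corridor without a bottleneck. -/
def withoutBottleneck (C : Corridor) : Corridor := { C with qbn := fun _ => C.capacity }

/-- A queue is active at the downstream end: fewer vehicles have left than would have left
without the bottleneck. -/
def QueueActive (C : Corridor) (D : RushHour) (t : ℝ) : Prop :=
  C.cumulativeFlow D C.length t < C.withoutBottleneck.cumulativeFlow D C.length t

/-- The times at which the exit flow equals the capacity of the downstream end. -/
def saturatedTimes (C : Corridor) (D : RushHour) : Set ℝ :=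
  {t | 0 ≤ t ∧ C.exitFlow D t = C.exitCapacity}

end Corridor

/-- The curve `t ↦ (A t, P t)`, `t ≥ 0`, with `A` on the horizontal axis, is never traversed
clockwise: if it returns to the same `A`, then at the later time `P` is not lower; and after
time `0` it is strictly higher unless `P` did not move at all in between. -/
def IsCounterclockwise (A P : ℝ → ℝ) : Prop :=
  (∀ t₁ t₂, 0 ≤ t₁ → t₁ < t₂ → A t₁ = A t₂ → P t₁ ≤ P t₂) ∧
  (∀ t₁ t₂, 0 < t₁ → t₁ < t₂ → A t₁ = A t₂ →
    P t₁ < P t₂ ∨ ∀ t ∈ Icc t₁ t₂, P t = P t₁)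

/-- `A` rises to a maximum and falls afterwards. -/
def RisesThenFalls (A : ℝ → ℝ) : Prop :=
  ∃ tmax, 0 ≤ tmax ∧ MonotoneOn A (Icc 0 tmax) ∧ AntitoneOn A (Ici tmax)

end

/-!
The cumulative flow is an infimum over observer paths, and the proof evaluates it at both ends of
the link far enough to compare them.

*Downstream end.* Let `K q = freeDensity q` be the density of uncongested traffic with flow `q`, a
strictly increasing convex function, and let `c` be the exit capacity. Since the local capacity is
least at the downstream end, an optimal path to that end travels with constant velocity and then
waits there. Its cost is `crossingCost τ = sup_{0 ≤ q ≤ c} (τ q - length * K q)`, and with the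
demand `g` continued by `qb` to negative times, `N(length, t)` is the infimal convolution
`exitCount` of the cumulative demand with `crossingCost` (`cumulativeFlow_length`). The minimizers
`s` of this convolution, the `entryTimes` of `t`, carry the argument. By the first order condition
`g s` is an optimal flow for the travel time `t - s` (`isOptimalFlow_of_mem_entryTimes`), waves do
not overtake each other because `crossingCost` is convex (`entryTimes_exchange`), and the right
derivative of the exit count, that is the exit flow `P t`, is the least `g s` over all entry times
(`hasDerivWithinAt_exitCount`). Hence `P` inherits unimodality from the demand, and `P t < c` means
that the bottleneck does not matter at time `t`.

*Upstream end.* Only lower bounds for `N(0, t)` are needed. A path to `(0, t)` which starts before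
an entry time `s` has to cross the wave from `(0, s)` to `(length, t)`, and up to the crossing it
is not cheaper than the wave (`pathValues_zero_cases`). Moreover a loop of any duration can be cut
out of a path that returns to its starting point, so that the inflow is at least `c` while a queue
waits upstream (`pathValues_zero_cut`).

*Comparison.* If `g s = P t` for an entry time `s` of `t`, then either the accumulation `A t` is at
least `length * K (P t)`, or the link is emptying: all demand has entered and the inflow is below
the exit flow, which then persists (`accumulation_dichotomy`, `Emptying.later`). For an entry time
`s` during falling demand, on the other hand, `A t ≤ length * K (g s)`, strictly unless `g s` is
the end flow (`accumulation_le_of_toff_le`, `accumulation_lt_of_toff_le`). A later state with lower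
exit flow stems from falling demand, so that it has fewer vehicles; this is the orientation of the
loop, and the equality cases give the strict statements. The accumulation does not decrease as long
as the link is not emptying, which yields its rise and fall.
-/

/-! ### The fundamental diagram and its uncongested inverse -/

namespace Corridor

variable {C : Corridor}

namespace IsValid

lemma le_capacity (hC : C.IsValid) {k : ℝ} (hk : k ∈ Icc 0 C.jam) : C.Q k ≤ C.capacity :=
  le_csSup (isCompact_Icc.image_of_continuousOn hC.continuous).bddAbove (mem_image_of_mem _ hk)

lemma exists_eq_capacity (hC : C.IsValid) : ∃ k ∈ Icc 0 C.jam, C.Q k = C.capacity :=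
  (isCompact_Icc.image_of_continuousOn hC.continuous).sSup_mem
    ((nonempty_Icc.2 hC.jam_pos.le).image _)

lemma Q_nonneg (hC : C.IsValid) {k : ℝ} (hk : k ∈ Icc 0 C.jam) : 0 ≤ C.Q k := by
  have h := hC.concave.min_le_of_mem_Icc (left_mem_Icc.2 hC.jam_pos.le)
    (right_mem_Icc.2 hC.jam_pos.le) hk
  simpa [hC.Q_zero, hC.Q_jam] using h

lemma localCapacity_le_capacity (hC : C.IsValid) {x : ℝ} (hx : x ≤ C.length) :
    C.localCapacity x ≤ C.capacity := by
  unfold localCapacity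
  split_ifs with h
  · exact le_rfl
  · rw [← hC.qbn_start]
    exact hC.qbn_antitone ⟨le_rfl, hC.x0_mem.2⟩ ⟨not_lt.1 h, hx⟩ (not_lt.1 h)

lemma localCapacity_anti (hC : C.IsValid) {x y : ℝ} (hxy : x ≤ y) (hy : y ≤ C.length) :
    C.localCapacity y ≤ C.localCapacity x := by
  by_cases hx : x < C.x0
  · simpa [localCapacity, hx] using hC.localCapacity_le_capacity hy
  · have hy' : ¬ y < C.x0 := fun h => hx (hxy.trans_lt h)
    simp only [localCapacity, hx, hy', if_false]
    exact hC.qbn_antitone ⟨not_lt.1 hx, hxy.trans hy⟩ ⟨not_lt.1 hy', hy⟩ hxy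

lemma exitCapacity_le (hC : C.IsValid) {x : ℝ} (hx : x ≤ C.length) :
    C.exitCapacity ≤ C.localCapacity x := hC.localCapacity_anti hx le_rfl

lemma exitCapacity_le_capacity (hC : C.IsValid) : C.exitCapacity ≤ C.capacity :=
  hC.localCapacity_le_capacity le_rfl

/-- Every flow between `0` and `Q k` is carried by some density not larger than `k`. -/
lemma exists_density_le (hC : C.IsValid) {k q : ℝ} (hk : k ∈ Icc 0 C.jam) (hq : 0 ≤ q)
    (hqk : q ≤ C.Q k) : ∃ k' ∈ Icc 0 k, C.Q k' = q := by
  have h := intermediate_value_Icc hk.1 (hC.continuous.mono (Icc_subset_Icc le_rfl hk.2))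
  exact h ⟨by rwa [hC.Q_zero], hqk⟩

lemma freeDensity_mem (hC : C.IsValid) {q : ℝ} (hq : q ∈ Icc 0 C.capacity) :
    C.freeDensity q ∈ Icc 0 C.jam ∧ C.Q (C.freeDensity q) = q := by
  have hclosed : IsClosed {k | k ∈ Icc 0 C.jam ∧ C.Q k = q} :=
    hC.continuous.preimage_isClosed_of_isClosed isClosed_Icc isClosed_singleton
  obtain ⟨k, hk, hkq⟩ := hC.exists_eq_capacity
  obtain ⟨k', hk', hk'q⟩ := hC.exists_density_le hk hq.1 (hkq ▸ hq.2)
  have hne : {k | k ∈ Icc 0 C.jam ∧ C.Q k = q}.Nonempty :=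
    ⟨k', ⟨hk'.1, hk'.2.trans hk.2⟩, hk'q⟩
  have hbdd : BddBelow {k | k ∈ Icc 0 C.jam ∧ C.Q k = q} := ⟨0, fun k hk => hk.1.1⟩
  exact hclosed.csInf_mem hne hbdd

lemma freeDensity_nonneg (hC : C.IsValid) {q : ℝ} (hq : q ∈ Icc 0 C.capacity) :
    0 ≤ C.freeDensity q := (hC.freeDensity_mem hq).1.1

/-- The uncongested density is the least one that carries at least the given flow. -/
lemma freeDensity_le (hC : C.IsValid) {k q : ℝ} (hk : k ∈ Icc 0 C.jam) (hq : 0 ≤ q)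
    (hqk : q ≤ C.Q k) : C.freeDensity q ≤ k := by
  obtain ⟨k', hk', hk'q⟩ := hC.exists_density_le hk hq hqk
  have hbdd : BddBelow {k | k ∈ Icc 0 C.jam ∧ C.Q k = q} := ⟨0, fun k hk => hk.1.1⟩
  have hmem : k' ∈ {k | k ∈ Icc 0 C.jam ∧ C.Q k = q} := ⟨⟨hk'.1, hk'.2.trans hk.2⟩, hk'q⟩
  exact (csInf_le hbdd hmem).trans hk'.2

lemma freeDensity_zero (hC : C.IsValid) : C.freeDensity 0 = 0 :=
  le_antisymm (hC.freeDensity_le (left_mem_Icc.2 hC.jam_pos.le) le_rfl hC.Q_zero.ge)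
    (Real.sInf_nonneg fun _ hk => hk.1.1)

lemma freeDensity_strictMonoOn (hC : C.IsValid) :
    StrictMonoOn C.freeDensity (Icc 0 C.capacity) := by
  intro p hp q hq hpq
  have h := hC.freeDensity_mem hq
  refine lt_of_le_of_ne (hC.freeDensity_le h.1 hp.1 (h.2.symm ▸ hpq.le)) fun he => ?_
  rw [← he, (hC.freeDensity_mem hp).2] at h
  exact hpq.ne h.2

lemma freeDensity_convexOn (hC : C.IsValid) : ConvexOn ℝ (Icc 0 C.capacity) C.freeDensity := by
  refine ⟨convex_Icc _ _, fun p hp q hq α β hα hβ hαβ => ?_⟩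
  have h1 := hC.freeDensity_mem hp
  have h2 := hC.freeDensity_mem hq
  refine hC.freeDensity_le (convex_Icc _ _ h1.1 h2.1 hα hβ hαβ)
    (convex_Icc _ _ hp hq hα hβ hαβ).1 ?_
  simpa only [h1.2, h2.2] using hC.concave.2 h1.1 h2.1 hα hβ hαβ

/-- A subgradient of the uncongested density, scaled by the length of the link: the time that
waves of flow `q` need to travel through the link. -/
lemma exists_travelTime (hC : C.IsValid) {q : ℝ} (hq : q ∈ Ico 0 C.capacity) :
    ∃ τ, 0 ≤ τ ∧ ∀ p ∈ Icc 0 C.capacity,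
      τ * p - C.length * C.freeDensity p ≤ τ * q - C.length * C.freeDensity q := by
  have hl := hC.length_pos
  have hq' : q ∈ Icc 0 C.capacity := Ico_subset_Icc_self hq
  -- the right derivative of the convex function `freeDensity` at `q`
  set T : Set ℝ := (fun p => (C.freeDensity p - C.freeDensity q) / (p - q)) '' Ioc q C.capacity
    with hT
  have hT0 : ∀ y ∈ T, 0 ≤ y := by
    rintro _ ⟨p, hp, rfl⟩
    have := hC.freeDensity_strictMonoOn hq' ⟨hq.1.trans hp.1.le, hp.2⟩ hp.1
    exact div_nonneg (by linarith) (by linarith [hp.1])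
  have hTne : T.Nonempty := ⟨_, C.capacity, ⟨hq.2, le_rfl⟩, rfl⟩
  refine ⟨C.length * sInf T, mul_nonneg hl.le (Real.sInf_nonneg hT0), fun p hp => ?_⟩
  have key : sInf T * (p - q) ≤ C.freeDensity p - C.freeDensity q := by
    rcases lt_trichotomy p q with h | h | h
    · have : (C.freeDensity q - C.freeDensity p) / (q - p) ≤ sInf T := by
        refine le_csInf hTne ?_
        rintro _ ⟨r, hr, rfl⟩
        exact hC.freeDensity_convexOn.slope_mono_adjacent hp ⟨hq.1.trans hr.1.le, hr.2⟩ h hr.1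
      rw [div_le_iff₀ (by linarith)] at this
      linarith
    · simp [h]
    · have : sInf T ≤ (C.freeDensity p - C.freeDensity q) / (p - q) :=
        csInf_le ⟨0, hT0⟩ ⟨p, ⟨h, hp.2⟩, rfl⟩
      rwa [le_div_iff₀ (by linarith)] at this
  nlinarith [mul_le_mul_of_nonneg_left key hl.le]

/-- A flow below `c` that is optimal among the flows up to `c` is optimal among all flows. -/
lemma optimal_of_lt (hC : C.IsValid) {c q τ : ℝ} (hc : c ≤ C.capacity)
    (hq : 0 ≤ q) (hqc : q < c)
    (h : ∀ p ∈ Icc 0 c, τ * p - C.length * C.freeDensity p ≤ τ * q - C.length * C.freeDensity q)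
    {p : ℝ} (hp : p ∈ Icc 0 C.capacity) :
    τ * p - C.length * C.freeDensity p ≤ τ * q - C.length * C.freeDensity q := by
  have hl := hC.length_pos
  by_cases hpc : p ≤ c
  · exact h p ⟨hp.1, hpc⟩
  rw [not_le] at hpc
  have hqp : q < p := hqc.trans hpc
  have h1 := h c ⟨hq.trans hqc.le, le_rfl⟩
  have h2 := hC.freeDensity_convexOn.slope_mono_adjacent ⟨hq, (hqc.le.trans hc)⟩ hp hqc hpc
  rw [div_le_div_iff₀ (by linarith) (by linarith)] at h2
  have h3 : τ * (c - q) ≤ C.length * (C.freeDensity c - C.freeDensity q) := by linarith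
  have h4 : τ * (c - q) * (p - c) ≤ C.length * (C.freeDensity p - C.freeDensity c) * (c - q) := by
    nlinarith [mul_le_mul_of_nonneg_right h3 (sub_nonneg.2 hpc.le),
      mul_le_mul_of_nonneg_left h2 hl.le]
  have h5 : τ * (p - c) ≤ C.length * (C.freeDensity p - C.freeDensity c) := by
    have : 0 < c - q := by linarith
    nlinarith
  linarith

lemma exists_optimal (hC : C.IsValid) {c : ℝ} (hc : c ∈ Icc 0 C.capacity) (τ : ℝ) :
    ∃ q ∈ Icc 0 c, ∀ p ∈ Icc 0 c,
      τ * p - C.length * C.freeDensity p ≤ τ * q - C.length * C.freeDensity q := by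
  have hl := hC.length_pos
  have hcont : ContinuousOn (fun k => τ * min (C.Q k) c - C.length * k) (Icc 0 C.jam) := by
    have := hC.continuous
    fun_prop
  obtain ⟨k, hk, hmax⟩ := isCompact_Icc.exists_isMaxOn (nonempty_Icc.2 hC.jam_pos.le) hcont
  have hk0 : 0 ≤ min (C.Q k) c := le_min (hC.Q_nonneg hk) hc.1
  refine ⟨min (C.Q k) c, ⟨hk0, min_le_right _ _⟩, fun p hp => ?_⟩
  have hm := hC.freeDensity_mem ⟨hp.1, hp.2.trans hc.2⟩
  have h1 := hmax hm.1
  have h2 := hC.freeDensity_le hk hk0 (min_le_left _ _)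
  simp only [mem_ofPred_eq, hm.2, min_eq_left hp.2] at h1
  nlinarith [mul_le_mul_of_nonneg_left h2 hl.le]

/-! ### The passing rate -/

lemma passingRate_bddAbove (hC : C.IsValid) (κ u : ℝ) :
    BddAbove ((fun k => min (C.Q k) κ - u * k) '' Icc 0 C.jam) := by
  refine ⟨C.capacity + |u| * C.jam, ?_⟩
  rintro _ ⟨k, hk, rfl⟩
  have h1 : min (C.Q k) κ ≤ C.capacity := (min_le_left _ _).trans (hC.le_capacity hk)
  have h2 : -(u * k) ≤ |u| * C.jam :=
    calc -(u * k) ≤ |u| * k := by nlinarith [neg_abs_le u, hk.1]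
      _ ≤ |u| * C.jam := mul_le_mul_of_nonneg_left hk.2 (abs_nonneg u)
  simp only
  linarith

lemma le_passingRate (hC : C.IsValid) {x q : ℝ} (hx : x ≤ C.length)
    (hq : q ∈ Icc 0 C.exitCapacity) (u : ℝ) :
    q - u * C.freeDensity q ≤ C.passingRate x u := by
  have hm := hC.freeDensity_mem ⟨hq.1, hq.2.trans hC.exitCapacity_le_capacity⟩
  refine le_csSup (hC.passingRate_bddAbove _ u) ⟨_, hm.1, ?_⟩
  simp [localQ, hm.2, min_eq_left (hq.2.trans (hC.exitCapacity_le hx))]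

lemma passingRate_le (hC : C.IsValid) {x q u : ℝ} (hu : 0 ≤ u)
    (hq : ∀ p ∈ Icc 0 C.capacity, p - u * C.freeDensity p ≤ q - u * C.freeDensity q) :
    C.passingRate x u ≤ q - u * C.freeDensity q := by
  refine csSup_le ((nonempty_Icc.2 hC.jam_pos.le).image _) ?_
  rintro _ ⟨k, hk, rfl⟩
  have h0 := hC.Q_nonneg hk
  have h1 := hC.freeDensity_le hk h0 le_rfl
  have h2 := hq _ ⟨h0, hC.le_capacity hk⟩
  have h3 : C.localQ x k ≤ C.Q k := min_le_left _ _
  simp only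
  nlinarith [mul_le_mul_of_nonneg_left h1 hu]

lemma passingRate_zero_le (hC : C.IsValid) (x : ℝ) :
    C.passingRate x 0 ≤ C.localCapacity x := by
  refine csSup_le ((nonempty_Icc.2 hC.jam_pos.le).image _) ?_
  rintro _ ⟨k, hk, rfl⟩
  simp [localQ]

end IsValid
end Corridor

/-! ### The upstream demand -/

namespace RushHour

/-- The upstream flow, continued to negative times by its initial value. -/
def demand (D : RushHour) (t : ℝ) : ℝ :=
  min (D.qb + D.a * max t 0) D.qp - min (D.b * max (t - D.toff) 0) (D.qp - D.qe)

/-- Cumulative demand, counted from time `0` and negative before. -/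
noncomputable def arrivals (D : RushHour) (t : ℝ) : ℝ := ∫ r in (0 : ℝ)..t, D.demand r

variable {C : Corridor} {D : RushHour}

lemma continuous_demand (D : RushHour) : Continuous D.demand := by
  unfold demand; fun_prop

lemma hasDerivAt_arrivals (D : RushHour) (t : ℝ) : HasDerivAt D.arrivals (D.demand t) t :=
  intervalIntegral.integral_hasDerivAt_right (D.continuous_demand.intervalIntegrable _ _)
    (D.continuous_demand.stronglyMeasurableAtFilter _ _) D.continuous_demand.continuousAt

lemma continuous_arrivals (D : RushHour) : Continuous D.arrivals :=
  continuous_iff_continuousAt.2 fun t => (D.hasDerivAt_arrivals t).continuousAt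

lemma arrivals_zero (D : RushHour) : D.arrivals 0 = 0 := by simp [arrivals]

lemma arrivals_sub (D : RushHour) (u v : ℝ) :
    D.arrivals v - D.arrivals u = ∫ r in u..v, D.demand r :=
  intervalIntegral.integral_interval_sub_left (D.continuous_demand.intervalIntegrable _ _)
    (D.continuous_demand.intervalIntegrable _ _)

lemma le_arrivals_sub (D : RushHour) {u v q : ℝ} (huv : u ≤ v)
    (h : ∀ r ∈ Icc u v, q ≤ D.demand r) : q * (v - u) ≤ D.arrivals v - D.arrivals u := by
  have := intervalIntegral.integral_mono_on huv (f := fun _ => q) (by simp)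
    (D.continuous_demand.intervalIntegrable u v (μ := volume)) h
  rw [arrivals_sub]
  simpa [mul_comm] using this

lemma arrivals_sub_le (D : RushHour) {u v q : ℝ} (huv : u ≤ v)
    (h : ∀ r ∈ Icc u v, D.demand r ≤ q) : D.arrivals v - D.arrivals u ≤ q * (v - u) := by
  have := intervalIntegral.integral_mono_on huv (g := fun _ => q)
    (D.continuous_demand.intervalIntegrable u v (μ := volume)) (by simp) h
  rw [arrivals_sub]
  simpa [mul_comm] using this

lemma lt_arrivals_sub (D : RushHour) {u v q : ℝ} (huv : u < v)
    (h : ∀ r ∈ Ioo u v, q < D.demand r) : q * (v - u) < D.arrivals v - D.arrivals u := by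
  obtain ⟨r, hr, hr'⟩ := exists_hasDerivAt_eq_slope D.arrivals D.demand huv
    D.continuous_arrivals.continuousOn fun r _ => D.hasDerivAt_arrivals r
  have := h r hr
  rwa [hr', lt_div_iff₀ (by linarith)] at this

lemma arrivals_sub_lt (D : RushHour) {u v q : ℝ} (huv : u < v)
    (h : ∀ r ∈ Ioo u v, D.demand r < q) : D.arrivals v - D.arrivals u < q * (v - u) := by
  obtain ⟨r, hr, hr'⟩ := exists_hasDerivAt_eq_slope D.arrivals D.demand huv
    D.continuous_arrivals.continuousOn fun r _ => D.hasDerivAt_arrivals r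
  have := h r hr
  rwa [hr', div_lt_iff₀ (by linarith)] at this

namespace IsValid

lemma toff_pos (hD : D.IsValid C) : 0 < D.toff :=
  (div_pos (sub_pos.2 hD.qb_lt_qp) hD.a_pos).trans_le hD.peak_le_toff

lemma peak_le (hD : D.IsValid C) {t : ℝ} (ht : D.toff ≤ t) : D.qp ≤ D.qb + D.a * t := by
  have h := (div_le_iff₀ hD.a_pos).1 (hD.peak_le_toff.trans ht)
  linarith

lemma demand_of_le (hD : D.IsValid C) {t : ℝ} (ht : t ≤ D.toff) :
    D.demand t = min (D.qb + D.a * max t 0) D.qp := by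
  rw [demand, max_eq_right (sub_nonpos.2 ht), mul_zero,
    min_eq_left (sub_nonneg.2 hD.qe_lt_qp.le), sub_zero]

lemma demand_of_ge (hD : D.IsValid C) {t : ℝ} (ht : D.toff ≤ t) :
    D.demand t = max (D.qp - D.b * (t - D.toff)) D.qe := by
  have h := hD.peak_le ht
  rw [demand, max_eq_left (sub_nonneg.2 ht), max_eq_left (hD.toff_pos.le.trans ht),
    min_eq_right h]
  rcases le_total (D.b * (t - D.toff)) (D.qp - D.qe) with h' | h'
  · rw [min_eq_left h', max_eq_left (by linarith)]
  · rw [min_eq_right h', max_eq_right (by linarith)]; ring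

lemma demand_of_nonpos (hD : D.IsValid C) {t : ℝ} (ht : t ≤ 0) : D.demand t = D.qb := by
  rw [hD.demand_of_le (ht.trans hD.toff_pos.le), max_eq_right ht, mul_zero, add_zero,
    min_eq_left hD.qb_lt_qp.le]

lemma demand_toff (hD : D.IsValid C) : D.demand D.toff = D.qp := by
  rw [hD.demand_of_ge le_rfl, sub_self, mul_zero, sub_zero, max_eq_left hD.qe_lt_qp.le]

lemma demand_mono (hD : D.IsValid C) : MonotoneOn D.demand (Iic D.toff) := by
  intro u hu v hv huv
  rw [hD.demand_of_le hu, hD.demand_of_le hv]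
  have := hD.a_pos.le
  gcongr

lemma demand_anti (hD : D.IsValid C) : AntitoneOn D.demand (Ici D.toff) := by
  intro u hu v hv huv
  rw [hD.demand_of_ge hu, hD.demand_of_ge hv]
  have := hD.b_pos.le
  gcongr

/-- The demand rises strictly after time `0` until it has reached its peak. -/
lemma demand_lt_of_rise (hD : D.IsValid C) {u v : ℝ} (huv : u < v) (hv0 : 0 < v)
    (hv : v ≤ D.toff) (hu : D.demand u < D.qp) : D.demand u < D.demand v := by
  rw [hD.demand_of_le (huv.le.trans hv)] at hu ⊢
  rw [hD.demand_of_le hv]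
  have h1 : D.qb + D.a * max u 0 < D.qp := by
    rcases min_lt_iff.1 hu with h | h
    · exact h
    · exact absurd h (lt_irrefl _)
  have h2 : max u 0 < max v 0 := by
    rw [max_eq_left hv0.le]; exact max_lt huv hv0
  have h3 := mul_lt_mul_of_pos_left h2 hD.a_pos
  rw [min_eq_left h1.le]
  exact lt_min (by linarith) h1

/-- The demand falls strictly until it has reached its end value. -/
lemma demand_lt_of_fall (hD : D.IsValid C) {u v : ℝ} (huv : u < v) (hu : D.toff ≤ u)
    (hue : D.demand u ≠ D.qe) : D.demand v < D.demand u := by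
  rw [hD.demand_of_ge hu] at hue ⊢
  rw [hD.demand_of_ge (hu.trans huv.le)]
  have h1 : D.qe < D.qp - D.b * (u - D.toff) := by
    by_contra h
    exact hue (max_eq_right (not_lt.1 h))
  have h3 := mul_lt_mul_of_pos_left huv hD.b_pos
  rw [max_eq_left h1.le]
  exact max_lt (by linarith) h1

lemma qe_le_demand (hD : D.IsValid C) {t : ℝ} (ht : D.toff ≤ t) : D.qe ≤ D.demand t := by
  rw [hD.demand_of_ge ht]; exact le_max_right _ _

lemma qb_le_demand (hD : D.IsValid C) {t : ℝ} (ht : t ≤ D.toff) : D.qb ≤ D.demand t := by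
  rw [hD.demand_of_le ht]
  exact le_min (le_add_of_nonneg_right (mul_nonneg hD.a_pos.le (le_max_right _ _)))
    hD.qb_lt_qp.le

lemma demand_nonneg (hD : D.IsValid C) (t : ℝ) : 0 ≤ D.demand t := by
  rcases le_total t D.toff with h | h
  · exact hD.qb_nonneg.trans (hD.qb_le_demand h)
  · exact hD.qe_nonneg.trans (hD.qe_le_demand h)

lemma exists_demand_eq_qe (hD : D.IsValid C) :
    ∃ te, D.toff ≤ te ∧ ∀ t, te ≤ t → D.demand t = D.qe := by
  have hb := hD.b_pos
  have h := sub_pos.2 hD.qe_lt_qp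
  refine ⟨D.toff + (D.qp - D.qe) / D.b, le_add_of_nonneg_right (by positivity), fun t ht => ?_⟩
  have h1 : (D.qp - D.qe) / D.b ≤ t - D.toff := by linarith
  rw [div_le_iff₀ hb] at h1
  have h2 : 0 ≤ (D.qp - D.qe) / D.b := by positivity
  rw [hD.demand_of_ge (by linarith), max_eq_right (by linarith)]

/-- The demand is unimodal. -/
lemma min_le_demand (hD : D.IsValid C) {u v w : ℝ} (huv : u ≤ v) (hvw : v ≤ w) :
    min (D.demand u) (D.demand w) ≤ D.demand v := by
  rcases le_total v D.toff with h | h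
  · exact (min_le_left _ _).trans (hD.demand_mono (huv.trans h) h huv)
  · exact (min_le_right _ _).trans (hD.demand_anti h (h.trans hvw) hvw)

lemma toff_lt_of_demand_lt (hD : D.IsValid C) {u v : ℝ} (huv : u ≤ v)
    (h : D.demand v < D.demand u) : D.toff < v := by
  by_contra hv
  rw [not_lt] at hv
  exact h.not_ge (hD.demand_mono (huv.trans hv) hv huv)

lemma lt_toff_of_demand_lt (hD : D.IsValid C) {u v : ℝ} (huv : u ≤ v)
    (h : D.demand u < D.demand v) : u < D.toff := by
  by_contra hv
  rw [not_lt] at hv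
  exact h.not_ge (hD.demand_anti hv (hv.trans huv) huv)

lemma demand_eq_flow (hD : D.IsValid C) {t : ℝ} (ht : 0 ≤ t) : D.demand t = D.flow t := by
  have ha := hD.a_pos
  have hb := hD.b_pos
  unfold flow
  split_ifs with h1 h2 h3
  · rw [hD.demand_of_le (h1.trans hD.peak_le_toff), max_eq_left ht, min_eq_left]
    rw [le_div_iff₀ ha] at h1; linarith
  · rw [hD.demand_of_le h2, max_eq_left ht, min_eq_right]
    rw [not_le, div_lt_iff₀ ha] at h1; linarith
  · rw [hD.demand_of_ge (not_le.1 h2).le, max_eq_left]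
    have : t - D.toff ≤ (D.qp - D.qe) / D.b := by linarith
    rw [le_div_iff₀ hb] at this; linarith
  · rw [hD.demand_of_ge (not_le.1 h2).le, max_eq_right]
    have : (D.qp - D.qe) / D.b < t - D.toff := by linarith
    rw [div_lt_iff₀ hb] at this; linarith

lemma cumulative_eq (hD : D.IsValid C) {t : ℝ} (ht : 0 ≤ t) : D.cumulative t = D.arrivals t := by
  refine intervalIntegral.integral_congr fun r hr => ?_
  rw [uIcc_of_le ht] at hr
  exact (hD.demand_eq_flow hr.1).symm

lemma arrivals_of_nonpos (hD : D.IsValid C) {t : ℝ} (ht : t ≤ 0) : D.arrivals t = D.qb * t := by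
  have h1 := D.le_arrivals_sub (q := D.qb) ht fun r hr => (hD.demand_of_nonpos hr.2).ge
  have h2 := D.arrivals_sub_le (q := D.qb) ht fun r hr => (hD.demand_of_nonpos hr.2).le
  rw [D.arrivals_zero] at h1 h2
  linarith

lemma arrivals_mono (hD : D.IsValid C) : Monotone D.arrivals := fun u v huv => by
  have := D.le_arrivals_sub (q := 0) huv fun r _ => hD.demand_nonneg r
  linarith

/-- The demand increases at most with slope `a`. -/
lemma demand_le_add (hD : D.IsValid C) {u v : ℝ} (huv : u ≤ v) :
    D.demand v ≤ D.demand u + D.a * (v - u) := by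
  have ha := hD.a_pos
  have h1 : min (D.qb + D.a * max v 0) D.qp ≤
      min (D.qb + D.a * max u 0) D.qp + D.a * (v - u) := by
    have h : max v 0 ≤ max u 0 + (v - u) :=
      max_le (by linarith [le_max_left u 0]) (by linarith [le_max_right u 0])
    have h' := mul_le_mul_of_nonneg_left h ha.le
    have h'' : 0 ≤ D.a * (v - u) := mul_nonneg ha.le (sub_nonneg.2 huv)
    rw [← min_add_add_right]
    refine le_min ((min_le_left _ _).trans (by linarith)) ((min_le_right _ _).trans (by linarith))
  have h2 : min (D.b * max (u - D.toff) 0) (D.qp - D.qe) ≤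
      min (D.b * max (v - D.toff) 0) (D.qp - D.qe) := by
    have := hD.b_pos.le
    gcongr
  unfold demand
  linarith

end IsValid
end RushHour

/-! ### The Legendre transform of the uncongested branch -/

namespace Corridor

variable {C : Corridor} {D : RushHour}

/-- The least number of vehicles that can overtake an observer who crosses the whole link in time
`τ` and may wait at its downstream end: the Legendre transform of `q ↦ length * freeDensity q` on
the flows `q` which the downstream end can carry. -/
noncomputable def crossingCost (C : Corridor) (τ : ℝ) : ℝ :=
  sSup ((fun q => τ * q - C.length * C.freeDensity q) '' Icc 0 C.exitCapacity)

/-- The flow `q` is optimal in the Legendre transform at `τ`. -/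
def IsOptimalFlow (C : Corridor) (τ q : ℝ) : Prop :=
  q ∈ Icc 0 C.exitCapacity ∧ C.crossingCost τ = τ * q - C.length * C.freeDensity q

lemma exit_mem (hC : C.IsValid) (hD : D.IsValid C) : C.exitCapacity ∈ Icc 0 C.capacity :=
  ⟨hD.qb_nonneg.trans hD.qb_lt_exit.le, hC.exitCapacity_le_capacity⟩

lemma exit_pos (hD : D.IsValid C) : 0 < C.exitCapacity := hD.qb_nonneg.trans_lt hD.qb_lt_exit

lemma freeDensity_mono_exit (hC : C.IsValid) {p q : ℝ} (hp : 0 ≤ p) (hpq : p ≤ q)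
    (hq : q ≤ C.exitCapacity) : C.freeDensity p ≤ C.freeDensity q := by
  have := hC.exitCapacity_le_capacity
  exact hC.freeDensity_strictMonoOn.monotoneOn ⟨hp, by linarith⟩ ⟨by linarith, by linarith⟩ hpq

lemma isOptimalFlow_of_forall {τ q : ℝ} (hq : q ∈ Icc 0 C.exitCapacity)
    (h : ∀ p ∈ Icc 0 C.exitCapacity,
      τ * p - C.length * C.freeDensity p ≤ τ * q - C.length * C.freeDensity q) :
    C.IsOptimalFlow τ q := by
  refine ⟨hq, IsGreatest.csSup_eq ⟨⟨q, hq, rfl⟩, ?_⟩⟩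
  rintro _ ⟨p, hp, rfl⟩
  exact h p hp

lemma exists_isOptimalFlow (hC : C.IsValid) (hD : D.IsValid C) (τ : ℝ) :
    ∃ q, C.IsOptimalFlow τ q := by
  obtain ⟨q, hq, h⟩ := hC.exists_optimal (exit_mem hC hD) τ
  exact ⟨q, isOptimalFlow_of_forall hq h⟩

lemma le_crossingCost (hC : C.IsValid) (hD : D.IsValid C) {q : ℝ}
    (hq : q ∈ Icc 0 C.exitCapacity) (τ : ℝ) :
    τ * q - C.length * C.freeDensity q ≤ C.crossingCost τ := by
  obtain ⟨p, hp, h⟩ := hC.exists_optimal (exit_mem hC hD) τ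
  rw [(isOptimalFlow_of_forall hp h).2]
  exact h q hq

lemma crossingCost_le_add (hC : C.IsValid) (hD : D.IsValid C) {τ σ : ℝ} (h : τ ≤ σ) :
    C.crossingCost σ ≤ C.crossingCost τ + C.exitCapacity * (σ - τ) := by
  obtain ⟨q, hq, hq'⟩ := exists_isOptimalFlow hC hD σ
  have := le_crossingCost hC hD hq τ
  have := mul_le_mul_of_nonneg_right hq.2 (sub_nonneg.2 h)
  rw [hq']; linarith

lemma crossingCost_mono (hC : C.IsValid) (hD : D.IsValid C) : Monotone C.crossingCost := by
  intro τ σ h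
  obtain ⟨q, hq, hq'⟩ := exists_isOptimalFlow hC hD τ
  have := le_crossingCost hC hD hq σ
  have := mul_le_mul_of_nonneg_left h hq.1
  rw [hq']; linarith

lemma continuous_crossingCost (hC : C.IsValid) (hD : D.IsValid C) : Continuous C.crossingCost := by
  have hc := (exit_mem hC hD).1
  refine (LipschitzWith.of_le_add_mul ⟨C.exitCapacity, hc⟩ fun x y => ?_).continuous
  rw [Real.dist_eq]
  rcases le_total x y with h | h
  · exact (crossingCost_mono hC hD h).trans (le_add_of_nonneg_right (by positivity))
  · rw [abs_of_nonneg (sub_nonneg.2 h)]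
    exact crossingCost_le_add hC hD h

lemma crossingCost_zero (hC : C.IsValid) (hD : D.IsValid C) : C.crossingCost 0 = 0 := by
  have h0 : (0 : ℝ) ∈ Icc 0 C.exitCapacity := left_mem_Icc.2 (exit_mem hC hD).1
  have h := isOptimalFlow_of_forall (C := C) (τ := 0) h0 fun p hp => by
    have := freeDensity_mono_exit hC le_rfl hp.1 hp.2
    nlinarith [mul_le_mul_of_nonneg_left this hC.length_pos.le]
  rw [h.2, hC.freeDensity_zero]; ring

/-- Convexity, in the form of an exchange inequality. -/
lemma crossingCost_exchange (hC : C.IsValid) (hD : D.IsValid C) {a b d e : ℝ}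
    (hab : a ≤ b) (hbe : b ≤ e) (h : a + e = b + d) :
    C.crossingCost b + C.crossingCost d ≤ C.crossingCost a + C.crossingCost e := by
  obtain ⟨q, hq, hq'⟩ := exists_isOptimalFlow hC hD b
  obtain ⟨p, hp, hp'⟩ := exists_isOptimalFlow hC hD d
  rw [hq', hp']
  have hde : d = a + e - b := by linarith
  have key : ∀ x y, x ∈ Icc 0 C.exitCapacity → y ∈ Icc 0 C.exitCapacity →
      a * x + e * y - C.length * C.freeDensity x - C.length * C.freeDensity y ≤
        C.crossingCost a + C.crossingCost e := fun x y hx hy => by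
    linarith [le_crossingCost hC hD hx a, le_crossingCost hC hD hy e]
  subst hde
  rcases le_total q p with hqp | hqp
  · nlinarith [key q p hq hp, mul_nonneg (sub_nonneg.2 hab) (sub_nonneg.2 hqp)]
  · nlinarith [key p q hp hq, mul_nonneg (sub_nonneg.2 hbe) (sub_nonneg.2 hqp)]

lemma crossingCost_convexOn (hC : C.IsValid) (hD : D.IsValid C) :
    ConvexOn ℝ univ C.crossingCost := by
  refine ⟨convex_univ, fun x _ y _ α β hα hβ hαβ => ?_⟩
  obtain ⟨q, hq, hq'⟩ := exists_isOptimalFlow hC hD (α • x + β • y)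
  have h1 := mul_le_mul_of_nonneg_left (le_crossingCost hC hD hq x) hα
  have h2 := mul_le_mul_of_nonneg_left (le_crossingCost hC hD hq y) hβ
  rw [hq']
  have : β = 1 - α := by linarith
  subst this
  simp only [smul_eq_mul] at *
  nlinarith

/-- Travel time of waves whose flow is below the exit capacity. -/
lemma exists_travelTime_optimal (hC : C.IsValid) {q : ℝ} (hq : q ∈ Ico 0 C.exitCapacity) :
    ∃ τ, 0 ≤ τ ∧ C.IsOptimalFlow τ q ∧ ∀ p ∈ Icc 0 C.capacity,
      τ * p - C.length * C.freeDensity p ≤ τ * q - C.length * C.freeDensity q := by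
  have hc := hC.exitCapacity_le_capacity
  obtain ⟨τ, hτ, h⟩ := hC.exists_travelTime ⟨hq.1, hq.2.trans_le hc⟩
  exact ⟨τ, hτ, isOptimalFlow_of_forall (Ico_subset_Icc_self hq)
    fun p hp => h p ⟨hp.1, hp.2.trans hc⟩, h⟩

/-- A subgradient `q` of the Legendre transform at `τ` is an optimal flow there. It suffices to test
the subgradient inequality at nonnegative arguments, because travel times are nonnegative. -/
lemma isOptimalFlow_of_subgradient (hC : C.IsValid) (hD : D.IsValid C) {τ q : ℝ} (hτ : 0 ≤ τ)
    (hq : 0 ≤ q)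
    (h : ∀ σ, 0 ≤ σ → C.crossingCost τ + q * (σ - τ) ≤ C.crossingCost σ) :
    C.IsOptimalFlow τ q := by
  have hqc : q ≤ C.exitCapacity := by
    have h1 := h (τ + 1) (by linarith)
    have h2 := crossingCost_le_add hC hD (show τ ≤ τ + 1 by linarith)
    linarith
  refine ⟨⟨hq, hqc⟩, le_antisymm ?_ (le_crossingCost hC hD ⟨hq, hqc⟩ τ)⟩
  rcases hqc.lt_or_eq with hlt | heq
  · obtain ⟨σ, hσ, hopt, -⟩ := exists_travelTime_optimal hC ⟨hq, hlt⟩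
    have h1 := h σ hσ
    rw [hopt.2] at h1
    linarith
  · obtain ⟨p, hp, hp'⟩ := exists_isOptimalFlow hC hD (τ + 1)
    have h1 := h (τ + 1) (by linarith)
    have h2 := le_crossingCost hC hD hp τ
    have : p = q := le_antisymm (heq ▸ hp.2) (by linarith)
    subst this
    linarith

lemma eq_zero_of_isOptimalFlow_zero (hC : C.IsValid) (hD : D.IsValid C) {q : ℝ}
    (h : C.IsOptimalFlow 0 q) : q = 0 := by
  have h1 := h.2
  rw [crossingCost_zero hC hD] at h1
  by_contra hne
  have h2 := hC.freeDensity_strictMonoOn (left_mem_Icc.2 (h.1.1.trans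
    (h.1.2.trans hC.exitCapacity_le_capacity)))
    ⟨h.1.1, h.1.2.trans hC.exitCapacity_le_capacity⟩ (lt_of_le_of_ne h.1.1 (Ne.symm hne))
  rw [hC.freeDensity_zero] at h2
  have := mul_pos hC.length_pos h2
  linarith

/-! ### Entry times -/

/-- Number of vehicles counted at the downstream end at time `t` by an observer who leaves the
upstream end at time `s`. -/
noncomputable def countFrom (C : Corridor) (D : RushHour) (t s : ℝ) : ℝ :=
  D.arrivals s + C.crossingCost (t - s)

/-- The entry times of the waves that determine the state at the downstream end at time `t`: the
minimizers of `countFrom`. The uncongested initial state appears as demand before time `0`. -/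
def entryTimes (C : Corridor) (D : RushHour) (t : ℝ) : Set ℝ :=
  {s | s ≤ t ∧ ∀ r ≤ t, C.countFrom D t s ≤ C.countFrom D t r}

/-- The minimum of `countFrom`: the infimal convolution of demand and `crossingCost`. -/
noncomputable def exitCount (C : Corridor) (D : RushHour) (t : ℝ) : ℝ :=
  sInf (C.countFrom D t '' Iic t)

lemma exitCount_eq {t s : ℝ} (hs : s ∈ C.entryTimes D t) :
    C.exitCount D t = C.countFrom D t s := by
  refine IsLeast.csInf_eq ⟨⟨s, hs.1, rfl⟩, ?_⟩
  rintro _ ⟨r, hr, rfl⟩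
  exact hs.2 r hr

lemma continuous_countFrom (hC : C.IsValid) (hD : D.IsValid C) :
    Continuous fun x : ℝ × ℝ => C.countFrom D x.1 x.2 :=
  (D.continuous_arrivals.comp continuous_snd).add
    ((continuous_crossingCost hC hD).comp (continuous_fst.sub continuous_snd))

/-- Lower bound for times `s` at which `countFrom` does not exceed the demand. -/
lemma lower_bound_of_countFrom_le (hC : C.IsValid) (hD : D.IsValid C) {t s : ℝ} (ht : 0 ≤ t)
    (h : C.countFrom D t s ≤ D.arrivals t) :
    -((D.arrivals t + C.length * C.freeDensity C.exitCapacity) /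
      (C.exitCapacity - D.qb)) ≤ s := by
  have hc := exit_mem hC hD
  have hpos : 0 < C.exitCapacity - D.qb := sub_pos.2 hD.qb_lt_exit
  have hG : 0 ≤ D.arrivals t := by
    have := hD.arrivals_mono ht
    rwa [D.arrivals_zero] at this
  have hK : 0 ≤ C.length * C.freeDensity C.exitCapacity :=
    mul_nonneg hC.length_pos.le (hC.freeDensity_nonneg hc)
  rw [neg_le, le_div_iff₀ hpos]
  rcases le_total 0 s with hs | hs
  · nlinarith
  · have h1 := le_crossingCost hC hD (right_mem_Icc.2 hc.1) (t - s)
    unfold countFrom at h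
    rw [hD.arrivals_of_nonpos hs] at h
    nlinarith [mul_nonneg ht hc.1]

lemma countFrom_self (hC : C.IsValid) (hD : D.IsValid C) (t : ℝ) :
    C.countFrom D t t = D.arrivals t := by
  simp [countFrom, crossingCost_zero hC hD]

lemma exists_entryTime (hC : C.IsValid) (hD : D.IsValid C) {t : ℝ} (ht : 0 ≤ t) :
    ∃ s, s ∈ C.entryTimes D t := by
  set M := -((D.arrivals t + C.length * C.freeDensity C.exitCapacity) /
      (C.exitCapacity - D.qb)) with hM
  have hMt : M ≤ t := lower_bound_of_countFrom_le hC hD ht (countFrom_self hC hD t).le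
  obtain ⟨s, hs, hmin⟩ := (isCompact_Icc (a := M) (b := t)).exists_isMinOn (nonempty_Icc.2 hMt)
    (((continuous_countFrom hC hD).comp (Continuous.prodMk_right t)).continuousOn)
  refine ⟨s, hs.2, fun r hr => ?_⟩
  by_cases h : C.countFrom D t r ≤ D.arrivals t
  · exact hmin ⟨lower_bound_of_countFrom_le hC hD ht h, hr⟩
  · refine le_trans ?_ (not_le.1 h).le
    rw [← countFrom_self hC hD t]
    exact hmin (right_mem_Icc.2 hMt)

lemma exitCount_le (hC : C.IsValid) (hD : D.IsValid C) {t r : ℝ} (ht : 0 ≤ t) (hr : r ≤ t) :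
    C.exitCount D t ≤ C.countFrom D t r := by
  obtain ⟨s, hs⟩ := exists_entryTime hC hD ht
  rw [exitCount_eq hs]
  exact hs.2 r hr

lemma entryTimes_lower_bound (hC : C.IsValid) (hD : D.IsValid C) {t u s : ℝ} (ht : 0 ≤ t)
    (htu : t ≤ u) (hs : s ∈ C.entryTimes D t) :
    -((D.arrivals u + C.length * C.freeDensity C.exitCapacity) /
      (C.exitCapacity - D.qb)) ≤ s := by
  have hpos : 0 < C.exitCapacity - D.qb := sub_pos.2 hD.qb_lt_exit
  refine le_trans ?_ (lower_bound_of_countFrom_le hC hD ht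
    ((hs.2 t le_rfl).trans (countFrom_self hC hD t).le))
  have := hD.arrivals_mono htu
  gcongr

/-- Entry times are upper hemicontinuous from the right. -/
lemma exists_entryTime_mem_of_frequently (hC : C.IsValid) (hD : D.IsValid C) {t : ℝ} (ht : 0 ≤ t)
    {Z : Set ℝ} (hZ : IsClosed Z)
    (h : ∀ δ > 0, ∃ u, t ≤ u ∧ u < t + δ ∧ (C.entryTimes D u ∩ Z).Nonempty) :
    (C.entryTimes D t ∩ Z).Nonempty := by
  have h' : ∀ n : ℕ, ∃ u s, t ≤ u ∧ u < t + 1 / ((n : ℝ) + 1) ∧ s ∈ C.entryTimes D u ∧ s ∈ Z := by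
    intro n
    obtain ⟨u, h1, h2, s, h3, h4⟩ := h (1 / ((n : ℝ) + 1)) (by positivity)
    exact ⟨u, s, h1, h2, h3, h4⟩
  choose u s hu1 hu2 hs hsZ using h'
  have hu : Filter.Tendsto u Filter.atTop (nhds t) := by
    refine tendsto_of_tendsto_of_tendsto_of_le_of_le tendsto_const_nhds ?_ hu1 fun n => (hu2 n).le
    simpa using tendsto_one_div_add_atTop_nhds_zero_nat.const_add t
  have hu3 : ∀ n, u n ≤ t + 1 := fun n => by
    refine (hu2 n).le.trans ?_
    have : 1 / ((n : ℝ) + 1) ≤ 1 := by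
      rw [div_le_one (by positivity)]; linarith [n.cast_nonneg (α := ℝ)]
    linarith
  obtain ⟨s', -, φ, hφ, hlim⟩ := isCompact_Icc.tendsto_subseq (x := s) fun n =>
    ⟨entryTimes_lower_bound hC hD (ht.trans (hu1 n)) (hu3 n) (hs n), (hs n).1.trans (hu3 n)⟩
  have hu' := hu.comp hφ.tendsto_atTop
  refine ⟨s', ⟨le_of_tendsto_of_tendsto' hlim hu' fun n => (hs _).1, fun r hr => ?_⟩,
    hZ.mem_of_tendsto hlim (Filter.Eventually.of_forall fun n => hsZ _)⟩
  have hcont := continuous_countFrom hC hD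
  exact le_of_tendsto_of_tendsto'
    ((hcont.tendsto (t, s')).comp (hu'.prodMk_nhds hlim))
    ((hcont.tendsto (t, r)).comp (hu'.prodMk_nhds tendsto_const_nhds))
    fun n => (hs (φ n)).2 r (hr.trans (hu1 _))

/-- Waves do not overtake each other: crossing entry times can be exchanged. -/
lemma entryTimes_exchange (hC : C.IsValid) (hD : D.IsValid C) {t u s r : ℝ} (htu : t ≤ u)
    (hs : s ∈ C.entryTimes D t) (hr : r ∈ C.entryTimes D u) (hrs : r ≤ s) :
    r ∈ C.entryTimes D t ∧ s ∈ C.entryTimes D u := by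
  have hst := hs.1
  have h := crossingCost_exchange hC hD (a := t - s) (b := t - r) (d := u - s) (e := u - r)
    (by linarith) (by linarith) (by ring)
  have h1 := hs.2 r (hrs.trans hst)
  have h2 := hr.2 s (hst.trans htu)
  refine ⟨⟨hrs.trans hst, fun w hw => le_trans ?_ (hs.2 w hw)⟩,
    ⟨hst.trans htu, fun w hw => le_trans ?_ (hr.2 w hw)⟩⟩ <;>
  · unfold countFrom at *
    linarith

/-- The flow at an entry time is optimal for the corresponding travel time. This is the first
order condition for a minimum of `countFrom`. -/
lemma isOptimalFlow_of_mem_entryTimes (hC : C.IsValid) (hD : D.IsValid C) {t s : ℝ}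
    (hs : s ∈ C.entryTimes D t) : C.IsOptimalFlow (t - s) (D.demand s) := by
  have hst := sub_nonneg.2 hs.1
  refine isOptimalFlow_of_subgradient hC hD hst (hD.demand_nonneg s) fun σ hσ => ?_
  -- along the segment from `t - s` to `σ`, compare the convex `crossingCost` with the demand
  have hslope : ∀ x ∈ Ioc (0 : ℝ) 1,
      D.arrivals s - D.arrivals (s - x * (σ - (t - s))) ≤
        x * (C.crossingCost σ - C.crossingCost (t - s)) := by
    intro x hx
    have h1 := hs.2 (s - x * (σ - (t - s))) (by nlinarith [hx.1, hx.2])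
    have h2 := (crossingCost_convexOn hC hD).2 (mem_univ (t - s)) (mem_univ σ)
      (sub_nonneg.2 hx.2) hx.1.le (by ring)
    have h3 : (1 - x) • (t - s) + x • σ = t - (s - x * (σ - (t - s))) := by
      simp only [smul_eq_mul]; ring
    rw [h3] at h2
    simp only [countFrom, smul_eq_mul] at h1 h2
    linarith
  have hderiv : HasDerivAt (fun x => D.arrivals s - D.arrivals (s - x * (σ - (t - s))))
      (D.demand s * (σ - (t - s))) 0 := by
    have h1 : HasDerivAt (fun x : ℝ => s - x * (σ - (t - s))) (-(σ - (t - s))) 0 := by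
      simpa using ((hasDerivAt_id (0 : ℝ)).mul_const (σ - (t - s))).const_sub s
    have h2 : HasDerivAt D.arrivals (D.demand s) (s - 0 * (σ - (t - s))) := by
      simpa using D.hasDerivAt_arrivals s
    have h3 := (h2.comp (0 : ℝ) h1).const_sub (D.arrivals s)
    rwa [mul_neg, neg_neg] at h3
  have hlim := (hasDerivWithinAt_iff_tendsto_slope' (s := Ioi (0 : ℝ))
    (by simp)).1 (hderiv.hasDerivWithinAt (s := Ioi 0))
  have hle : D.demand s * (σ - (t - s)) ≤ C.crossingCost σ - C.crossingCost (t - s) := by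
    refine le_of_tendsto hlim ?_
    filter_upwards [Ioc_mem_nhdsGT (zero_lt_one' ℝ)] with x hx
    rw [slope_def_field, sub_zero, div_le_iff₀ hx.1]
    simpa [mul_comm] using hslope x hx
  linarith

lemma demand_le_exit (hC : C.IsValid) (hD : D.IsValid C) {t s : ℝ} (hs : s ∈ C.entryTimes D t) :
    D.demand s ≤ C.exitCapacity := (isOptimalFlow_of_mem_entryTimes hC hD hs).1.2

lemma exitCount_eq_of_mem (hC : C.IsValid) (hD : D.IsValid C) {t s : ℝ}
    (hs : s ∈ C.entryTimes D t) : C.exitCount D t =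
      D.arrivals s + (D.demand s * (t - s) - C.length * C.freeDensity (D.demand s)) := by
  rw [exitCount_eq hs, countFrom, (isOptimalFlow_of_mem_entryTimes hC hD hs).2, mul_comm]

lemma demand_eq_zero_of_self_mem (hC : C.IsValid) (hD : D.IsValid C) {t : ℝ}
    (h : t ∈ C.entryTimes D t) : D.demand t = 0 := by
  have := isOptimalFlow_of_mem_entryTimes hC hD h
  rw [sub_self] at this
  exact eq_zero_of_isOptimalFlow_zero hC hD this

end Corridor

/-! ### The right derivative of the exit count -/

namespace Corridor

variable {C : Corridor} {D : RushHour}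

/-- Right derivative of the exit count. -/
noncomputable def exitRate (C : Corridor) (D : RushHour) (t : ℝ) : ℝ :=
  derivWithin (C.exitCount D) (Ici t) t

lemma exitCount_le_add (hC : C.IsValid) (hD : D.IsValid C) {t u : ℝ} (ht : 0 ≤ t) (htu : t ≤ u) :
    C.exitCount D u ≤ C.exitCount D t + C.exitCapacity * (u - t) := by
  obtain ⟨s, hs⟩ := exists_entryTime (D := D) hC hD ht
  have h1 := exitCount_le hC hD (ht.trans htu) (hs.1.trans htu)
  have h2 := crossingCost_le_add hC hD (show t - s ≤ u - s by linarith)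
  rw [exitCount_eq hs]
  unfold countFrom at *
  linarith

lemma exitCount_mono (hC : C.IsValid) (hD : D.IsValid C) : MonotoneOn (C.exitCount D) (Ici 0) := by
  intro t ht u hu htu
  obtain ⟨s, hs⟩ := exists_entryTime (D := D) hC hD hu
  rw [exitCount_eq hs]
  rcases le_total s t with h | h
  · have h1 := exitCount_le (D := D) hC hD ht h
    have h2 := crossingCost_mono hC hD (show t - s ≤ u - s by linarith)
    unfold countFrom at *
    linarith
  · have h1 := exitCount_le (D := D) hC hD ht le_rfl
    have h2 := crossingCost_mono hC hD (show 0 ≤ u - s by linarith [hs.1])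
    have h3 := hD.arrivals_mono h
    rw [countFrom_self hC hD] at h1
    rw [crossingCost_zero hC hD] at h2
    unfold countFrom
    linarith

lemma continuousOn_exitCount (hC : C.IsValid) (hD : D.IsValid C) :
    ContinuousOn (C.exitCount D) (Ici 0) := by
  have hc := (exit_mem hC hD).1
  refine (LipschitzOnWith.of_le_add_mul ⟨C.exitCapacity, hc⟩ fun x hx y hy => ?_).continuousOn
  rw [Real.dist_eq]
  rcases le_total x y with h | h
  · exact (exitCount_mono hC hD hx hy h).trans (le_add_of_nonneg_right (by positivity))
  · rw [abs_of_nonneg (sub_nonneg.2 h)]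
    exact exitCount_le_add hC hD hy h

lemma isClosed_demand_le (D : RushHour) (q : ℝ) : IsClosed {s | D.demand s ≤ q} :=
  isClosed_le D.continuous_demand continuous_const

/-- The exit count has a right derivative: the least demand among the entry times. -/
lemma hasDerivWithinAt_exitCount (hC : C.IsValid) (hD : D.IsValid C) {t s : ℝ} (ht : 0 ≤ t)
    (hs : s ∈ C.entryTimes D t) (hmin : ∀ r ∈ C.entryTimes D t, D.demand s ≤ D.demand r) :
    HasDerivWithinAt (C.exitCount D) (D.demand s) (Ici t) t := by
  rw [← hasDerivWithinAt_Ioi_iff_Ici, hasDerivWithinAt_iff_tendsto_slope' (by simp)]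
  refine tendsto_order.2 ⟨fun q hq => ?_, fun q hq => ?_⟩
  · -- later entry times have demand close to or above `demand s`; shift them back
    set q' := (q + D.demand s) / 2 with hq'
    have hne : ¬ (C.entryTimes D t ∩ {r | D.demand r ≤ q'}).Nonempty := by
      rintro ⟨r, hr, hr'⟩
      have h1 := hmin r hr
      simp only [mem_ofPred_eq] at hr'
      linarith
    have h := mt (exists_entryTime_mem_of_frequently hC hD ht (isClosed_demand_le D q')) hne
    push Not at h
    obtain ⟨δ, hδ, h⟩ := h
    have ha := hD.a_pos
    have hδ' : 0 < min δ ((q' - q) / D.a) := lt_min hδ (div_pos (by linarith) ha)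
    filter_upwards [Ioo_mem_nhdsGT (lt_add_of_pos_right t hδ')] with u hu
    have hut : 0 < u - t := sub_pos.2 hu.1
    have hu1 : u < t + δ := hu.2.trans_le (by linarith [min_le_left δ ((q' - q) / D.a)])
    have hu2 : (u - t) * D.a < q' - q := by
      rw [← lt_div_iff₀ ha]; linarith [hu.2, min_le_right δ ((q' - q) / D.a)]
    obtain ⟨r, hr⟩ := exists_entryTime (D := D) hC hD (ht.trans hu.1.le)
    have hrq : q' < D.demand r := by
      by_contra hcon
      have : r ∈ C.entryTimes D u ∩ {r | D.demand r ≤ q'} := ⟨hr, not_lt.1 hcon⟩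
      rw [h u hu.1.le hu1] at this
      exact this
    have h1 := exitCount_le (D := D) hC hD ht (show r - (u - t) ≤ t by linarith [hr.1])
    have h2 : t - (r - (u - t)) = u - r := by ring
    have h3 := D.lt_arrivals_sub (u := r - (u - t)) (v := r) (q := q) (by linarith)
      fun w hw => by
        have h4 := hD.demand_le_add hw.2.le
        nlinarith [hw.1]
    rw [slope_def_field, lt_div_iff₀ hut, exitCount_eq hr]
    unfold countFrom at *
    rw [h2] at h1
    linarith
  · -- shift the entry time `s` forward
    have hcont : ∀ᶠ w in nhds s, D.demand w < q := D.continuous_demand.continuousAt.eventually_lt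
      continuousAt_const hq
    obtain ⟨δ, hδ, hball⟩ := Metric.eventually_nhds_iff.1 hcont
    filter_upwards [Ioo_mem_nhdsGT (lt_add_of_pos_right t hδ)] with u hu
    have hut : 0 < u - t := sub_pos.2 hu.1
    have h1 := exitCount_le (D := D) hC hD (ht.trans hu.1.le)
      (show s + (u - t) ≤ u by linarith [hs.1])
    have h2 : u - (s + (u - t)) = t - s := by ring
    have h3 := D.arrivals_sub_lt (u := s) (v := s + (u - t)) (q := q) (by linarith)
      fun w hw => hball (by
        rw [Real.dist_eq, abs_of_pos (by linarith [hw.1])]; linarith [hw.2, hu.2])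
    rw [slope_def_field, div_lt_iff₀ hut, exitCount_eq hs]
    unfold countFrom at *
    rw [h2] at h1
    linarith

lemma isClosed_entryTimes (hC : C.IsValid) (hD : D.IsValid C) (t : ℝ) :
    IsClosed (C.entryTimes D t) := by
  have hcont : Continuous (C.countFrom D t) :=
    (continuous_countFrom hC hD).comp (Continuous.prodMk_right t)
  have : C.entryTimes D t = Iic t ∩ ⋂ r ∈ Iic t, {s | C.countFrom D t s ≤ C.countFrom D t r} := by
    ext s; simp [entryTimes]
  rw [this]
  exact isClosed_Iic.inter (isClosed_biInter fun r _ => isClosed_le hcont continuous_const)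

lemma exists_entryTime_exitRate (hC : C.IsValid) (hD : D.IsValid C) {t : ℝ} (ht : 0 ≤ t) :
    ∃ s ∈ C.entryTimes D t, D.demand s = C.exitRate D t ∧
      ∀ r ∈ C.entryTimes D t, D.demand s ≤ D.demand r := by
  have hcomp : IsCompact (C.entryTimes D t) :=
    isCompact_Icc.of_isClosed_subset (isClosed_entryTimes hC hD t)
      fun s hs => ⟨entryTimes_lower_bound hC hD ht le_rfl hs, hs.1⟩
  obtain ⟨s, hs, hmin⟩ := hcomp.exists_isMinOn (exists_entryTime hC hD ht)
    D.continuous_demand.continuousOn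
  exact ⟨s, hs, ((hasDerivWithinAt_exitCount hC hD ht hs hmin).derivWithin
    (uniqueDiffWithinAt_Ici t)).symm, hmin⟩

lemma exitCount_hasDeriv (hC : C.IsValid) (hD : D.IsValid C) {t : ℝ} (ht : 0 ≤ t) :
    HasDerivWithinAt (C.exitCount D) (C.exitRate D t) (Ici t) t := by
  obtain ⟨s, hs, he, hmin⟩ := exists_entryTime_exitRate hC hD ht
  exact he ▸ hasDerivWithinAt_exitCount hC hD ht hs hmin

lemma exitRate_le (hC : C.IsValid) (hD : D.IsValid C) {t s : ℝ} (ht : 0 ≤ t)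
    (hs : s ∈ C.entryTimes D t) : C.exitRate D t ≤ D.demand s := by
  obtain ⟨r, -, he, hmin⟩ := exists_entryTime_exitRate hC hD ht
  exact he ▸ hmin s hs

lemma exitRate_mem (hC : C.IsValid) (hD : D.IsValid C) {t : ℝ} (ht : 0 ≤ t) :
    C.exitRate D t ∈ Icc 0 C.exitCapacity := by
  obtain ⟨r, hr, he, -⟩ := exists_entryTime_exitRate hC hD ht
  exact he ▸ ⟨hD.demand_nonneg r, demand_le_exit hC hD hr⟩

/-- An entry time that realises the exit rate precedes every later entry time with a demand below
that rate. -/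
lemma entryTime_le_of_demand_lt (hC : C.IsValid) (hD : D.IsValid C) {t u s r : ℝ} (ht : 0 ≤ t)
    (htu : t ≤ u) (hs : s ∈ C.entryTimes D t) (hr : r ∈ C.entryTimes D u)
    (h : D.demand r < C.exitRate D t) : s ≤ r := by
  by_contra hrs
  have := (entryTimes_exchange hC hD htu hs hr (not_le.1 hrs).le).1
  exact h.not_ge (exitRate_le hC hD ht this)

lemma le_entryTime_of_demand_lt (hC : C.IsValid) (hD : D.IsValid C) {t u s r : ℝ} (ht : 0 ≤ t)
    (htu : t ≤ u) (hs : s ∈ C.entryTimes D t) (hr : r ∈ C.entryTimes D u)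
    (h : D.demand s < C.exitRate D u) : s ≤ r := by
  by_contra hrs
  have := (entryTimes_exchange hC hD htu hs hr (not_le.1 hrs).le).2
  exact h.not_ge (exitRate_le hC hD (ht.trans htu) this)

/-- The exit rate is unimodal. -/
lemma min_le_exitRate (hC : C.IsValid) (hD : D.IsValid C) {t u v : ℝ} (ht : 0 ≤ t) (htu : t ≤ u)
    (huv : u ≤ v) : min (C.exitRate D t) (C.exitRate D v) ≤ C.exitRate D u := by
  have hu := ht.trans htu
  obtain ⟨s, hs, hse, -⟩ := exists_entryTime_exitRate (D := D) hC hD ht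
  obtain ⟨r, hr, hre, -⟩ := exists_entryTime_exitRate (D := D) hC hD hu
  obtain ⟨w, hw, hwe, -⟩ := exists_entryTime_exitRate (D := D) hC hD (hu.trans huv)
  by_contra hcon
  rw [not_le, lt_min_iff] at hcon
  have h1 := entryTime_le_of_demand_lt hC hD ht htu hs hr (hre ▸ hcon.1)
  have h2 := le_entryTime_of_demand_lt hC hD hu huv hr hw (hre ▸ hcon.2)
  have h3 := hD.min_le_demand h1 h2
  rw [hse, hre, hwe] at h3
  exact h3.not_gt (lt_min hcon.1 hcon.2)

/-- If the exit rate drops between two times, the later state stems from falling demand. -/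
lemma toff_lt_of_exitRate_lt (hC : C.IsValid) (hD : D.IsValid C) {t u r : ℝ} (ht : 0 ≤ t)
    (htu : t ≤ u) (hr : r ∈ C.entryTimes D u) (h : D.demand r < C.exitRate D t) : D.toff < r := by
  obtain ⟨s, hs, hse, -⟩ := exists_entryTime_exitRate (D := D) hC hD ht
  exact hD.toff_lt_of_demand_lt (entryTime_le_of_demand_lt hC hD ht htu hs hr h) (hse ▸ h)

/-- Duality bound for the exit count with respect to waves that start at time `0`. -/
lemma exists_exitCount_le (hC : C.IsValid) (hD : D.IsValid C) {t : ℝ} (ht : 0 ≤ t) :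
    ∃ q ∈ Icc D.qb C.exitCapacity, C.exitCount D t ≤ t * q - C.length * C.freeDensity q := by
  obtain ⟨q, hq⟩ := exists_isOptimalFlow hC hD t
  by_cases hqb : D.qb ≤ q
  · refine ⟨q, ⟨hqb, hq.1.2⟩, (exitCount_le hC hD ht ht).trans ?_⟩
    rw [countFrom, D.arrivals_zero, sub_zero, hq.2, zero_add]
  · rw [not_le] at hqb
    obtain ⟨τ, hτ, hopt, -⟩ := exists_travelTime_optimal hC ⟨hD.qb_nonneg, hD.qb_lt_exit⟩
    have h1 := le_crossingCost hC hD hopt.1 t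
    have h2 := le_crossingCost hC hD hq.1 τ
    rw [hopt.2] at h2
    rw [hq.2] at h1
    have htτ : t ≤ τ := by nlinarith
    refine ⟨D.qb, ⟨le_rfl, hD.qb_lt_exit.le⟩,
      (exitCount_le hC hD ht (show t - τ ≤ t by linarith)).trans ?_⟩
    rw [countFrom, hD.arrivals_of_nonpos (by linarith), sub_sub_cancel, hopt.2]
    linarith

lemma exitRate_zero (hC : C.IsValid) (hD : D.IsValid C) : C.exitRate D 0 = D.qb := by
  obtain ⟨s, hs, hse, -⟩ := exists_entryTime_exitRate (D := D) hC hD le_rfl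
  rw [← hse, hD.demand_of_nonpos hs.1]

lemma exitCount_zero (hC : C.IsValid) (hD : D.IsValid C) :
    C.exitCount D 0 = -(C.length * C.freeDensity D.qb) := by
  obtain ⟨s, hs⟩ := exists_entryTime (D := D) hC hD le_rfl
  have hb : D.qb ∈ Icc 0 C.exitCapacity := ⟨hD.qb_nonneg, hD.qb_lt_exit.le⟩
  refine le_antisymm ?_ ?_
  · obtain ⟨q, hq, hle⟩ := exists_exitCount_le (D := D) hC hD le_rfl
    have := freeDensity_mono_exit hC hD.qb_nonneg hq.1 hq.2
    nlinarith [hC.length_pos]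
  · have := le_crossingCost hC hD hb (0 - s)
    rw [exitCount_eq hs, countFrom, hD.arrivals_of_nonpos hs.1]
    linarith

/-- After a long time only the end flow determines the exit. -/
lemma exists_entryTimes_late (hC : C.IsValid) (hD : D.IsValid C) (hqe : D.qe < C.exitCapacity) :
    ∃ T, 0 ≤ T ∧ ∀ t, T ≤ t → ∀ s ∈ C.entryTimes D t, D.toff ≤ s ∧ D.demand s = D.qe := by
  obtain ⟨te, hte, hdem⟩ := hD.exists_demand_eq_qe
  have hte0 : 0 ≤ te := hD.toff_pos.le.trans hte
  have hc := exit_mem hC hD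
  have hpos : 0 < C.exitCapacity - D.qe := sub_pos.2 hqe
  obtain ⟨τ, hτ, hopt, -⟩ := exists_travelTime_optimal hC ⟨hD.qe_nonneg, hqe⟩
  have hG : 0 ≤ D.arrivals te := by simpa [D.arrivals_zero] using hD.arrivals_mono hte0
  have hKc := mul_nonneg hC.length_pos.le (hC.freeDensity_nonneg hc)
  have hKe := mul_nonneg hC.length_pos.le (hC.freeDensity_nonneg
    ⟨hD.qe_nonneg, hqe.le.trans hc.2⟩)
  set L := (D.arrivals te + C.length * C.freeDensity C.exitCapacity) /
    (C.exitCapacity - D.qe) with hL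
  have hL0 : 0 ≤ L := by positivity
  refine ⟨te + τ + L + 1, by positivity, fun t ht s hs => ?_⟩
  suffices te ≤ s from ⟨hte.trans this, hdem s this⟩
  by_contra hcon
  rw [not_le] at hcon
  have h1 := hs.2 (t - τ) (by linarith)
  have h2 := D.arrivals_sub_le (u := te) (v := t - τ) (q := D.qe) (by linarith)
    fun r hr => (hdem r hr.1).le
  have h3 := le_crossingCost hC hD (right_mem_Icc.2 hc.1) (t - s)
  have h4 : -(C.exitCapacity * te) ≤ D.arrivals s - C.exitCapacity * s := by
    rcases le_total s 0 with h | h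
    · rw [hD.arrivals_of_nonpos h]
      nlinarith [hD.qb_lt_exit, hc.1]
    · have : 0 ≤ D.arrivals s := by simpa [D.arrivals_zero] using hD.arrivals_mono h
      nlinarith [hc.1]
  rw [countFrom, countFrom, sub_sub_cancel, hopt.2] at h1
  have h5 : L < t - te := by linarith
  rw [hL, div_lt_iff₀ hpos] at h5
  nlinarith

end Corridor

/-! ### Observer paths and their costs -/

namespace Corridor

variable {C : Corridor} {D : RushHour}

/-- The passing rate as a function of the local capacity instead of the position. -/
noncomputable def cappedRate (C : Corridor) (κ u : ℝ) : ℝ :=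
  sSup ((fun k => min (C.Q k) κ - u * k) '' Icc 0 C.jam)

lemma passingRate_eq (x u : ℝ) : C.passingRate x u = C.cappedRate (C.localCapacity x) u := rfl

lemma cappedRate_le (hC : C.IsValid) (κ κ' u u' : ℝ) :
    C.cappedRate κ u ≤ C.cappedRate κ' u' + (|κ - κ'| + C.jam * |u - u'|) := by
  refine csSup_le ((nonempty_Icc.2 hC.jam_pos.le).image _) ?_
  rintro _ ⟨k, hk, rfl⟩
  have h1 : min (C.Q k) κ' - u' * k ≤ C.cappedRate κ' u' :=
    le_csSup (hC.passingRate_bddAbove κ' u') ⟨k, hk, rfl⟩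
  have h2 : min (C.Q k) κ ≤ min (C.Q k) κ' + |κ - κ'| := by
    rw [← min_add_add_right]
    exact min_le_min (le_add_of_nonneg_right (abs_nonneg _)) (by linarith [le_abs_self (κ - κ')])
  have h3 : (u' - u) * k ≤ C.jam * |u - u'| :=
    calc (u' - u) * k ≤ |u - u'| * k :=
          mul_le_mul_of_nonneg_right (by rw [abs_sub_comm]; exact le_abs_self _) hk.1
      _ ≤ |u - u'| * C.jam := mul_le_mul_of_nonneg_left hk.2 (abs_nonneg _)
      _ = C.jam * |u - u'| := mul_comm _ _
  simp only
  linarith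

lemma continuous_cappedRate (hC : C.IsValid) :
    Continuous fun p : ℝ × ℝ => C.cappedRate p.1 p.2 := by
  refine (LipschitzWith.of_le_add_mul ⟨1 + C.jam, by linarith [hC.jam_pos]⟩
    fun p r => (cappedRate_le hC _ r.1 _ r.2).trans ?_).continuous
  have h1 : |p.1 - r.1| ≤ dist p r := le_max_left _ _
  have h2 : |p.2 - r.2| ≤ dist p r := le_max_right _ _
  have h3 := mul_le_mul_of_nonneg_left h2 hC.jam_pos.le
  change _ ≤ C.cappedRate r.1 r.2 + (1 + C.jam) * dist p r
  linarith

lemma cappedRate_nonneg (hC : C.IsValid) {κ : ℝ} (hκ : 0 ≤ κ) (u : ℝ) :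
    0 ≤ C.cappedRate κ u := by
  refine le_csSup_of_le (hC.passingRate_bddAbove κ u)
    ⟨0, left_mem_Icc.2 hC.jam_pos.le, rfl⟩ ?_
  simp [hC.Q_zero, hκ]

lemma cappedRate_le_of_abs (hC : C.IsValid) {u K : ℝ} (κ : ℝ) (hu : |u| ≤ K) :
    C.cappedRate κ u ≤ C.capacity + K * C.jam := by
  refine csSup_le ((nonempty_Icc.2 hC.jam_pos.le).image _) ?_
  rintro _ ⟨k, hk, rfl⟩
  have h1 : min (C.Q k) κ ≤ C.capacity := (min_le_left _ _).trans (hC.le_capacity hk)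
  have h2 : -(u * k) ≤ K * C.jam :=
    calc -(u * k) ≤ |u| * k := by nlinarith [neg_abs_le u, hk.1]
      _ ≤ |u| * C.jam := mul_le_mul_of_nonneg_left hk.2 (abs_nonneg u)
      _ ≤ K * C.jam := mul_le_mul_of_nonneg_right hu hC.jam_pos.le
  simp only
  linarith

namespace IsPath

variable {ξ : ℝ → ℝ} {s t x : ℝ}

lemma mono (h : C.IsPath ξ s t x) {u v : ℝ} (hu : s ≤ u) (hv : v ≤ t) :
    C.IsPath ξ u v (ξ v) :=
  ⟨h.1, fun r hr => h.2.1 r ⟨hu.trans hr.1, hr.2.trans hv⟩, rfl⟩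

lemma continuous (h : C.IsPath ξ s t x) : Continuous ξ := by
  obtain ⟨K, hK⟩ := h.1
  exact hK.continuous

lemma integral_deriv (h : C.IsPath ξ s t x) : ∫ r in s..t, deriv ξ r = ξ t - ξ s := by
  obtain ⟨K, hK⟩ := h.1
  exact (hK.lipschitzOnWith (s := uIcc s t)).absolutelyContinuousOnInterval.integral_deriv_eq_sub

lemma intervalIntegrable_deriv (h : C.IsPath ξ s t x) :
    IntervalIntegrable (deriv ξ) volume s t := by
  obtain ⟨K, hK⟩ := h.1
  exact (hK.lipschitzOnWith (s := uIcc s t)).absolutelyContinuousOnInterval.intervalIntegrable_deriv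

lemma intervalIntegrable (hC : C.IsValid) (hD : D.IsValid C) (h : C.IsPath ξ s t x)
    (hst : s ≤ t) :
    IntervalIntegrable (fun r => C.passingRate (ξ r) (deriv ξ r)) volume s t := by
  obtain ⟨K, hK⟩ := h.1
  rw [intervalIntegrable_iff_integrableOn_Ioc_of_le hst]
  -- cut positions off at the end of the link, where `localCapacity` is monotone
  have hanti : Antitone fun y => C.localCapacity (min y C.length) := fun y z hyz =>
    hC.localCapacity_anti (min_le_min_right _ hyz) (min_le_right _ _)
  have hmeas : Measurable fun r =>
      C.cappedRate (C.localCapacity (min (ξ r) C.length)) (deriv ξ r) :=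
    (continuous_cappedRate hC).measurable.comp
      ((hanti.measurable.comp hK.continuous.measurable).prodMk (measurable_deriv ξ))
  have hint : IntegrableOn (fun r =>
      C.cappedRate (C.localCapacity (min (ξ r) C.length)) (deriv ξ r)) (Ioc s t) volume := by
    refine Measure.integrableOn_of_bounded (M := C.capacity + K * C.jam) (by simp)
      hmeas.aestronglyMeasurable (Filter.Eventually.of_forall fun r => ?_)
    have h0 : 0 ≤ C.localCapacity (min (ξ r) C.length) :=
      (exit_mem hC hD).1.trans (hC.exitCapacity_le (min_le_right _ _))
    rw [Real.norm_of_nonneg (cappedRate_nonneg hC h0 _)]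
    exact cappedRate_le_of_abs hC _ (norm_deriv_le_of_lipschitz hK)
  refine hint.congr_fun (fun r hr => ?_) measurableSet_Ioc
  simp only [passingRate_eq, min_eq_left (h.2.1 r (Ioc_subset_Icc_self hr)).2]

/-- Weak duality: a lower bound for the cost of a path in terms of its end points. -/
lemma le_pathCost (hC : C.IsValid) (hD : D.IsValid C) (h : C.IsPath ξ s t x) (hst : s ≤ t)
    {q : ℝ} (hq : q ∈ Icc 0 C.exitCapacity) :
    q * (t - s) - C.freeDensity q * (ξ t - ξ s) ≤ C.pathCost ξ s t := by
  have hi := h.intervalIntegrable_deriv.mul_const (C.freeDensity q)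
  have hle := intervalIntegral.integral_mono_on hst (intervalIntegrable_const.sub hi)
    (h.intervalIntegrable hC hD hst)
    fun r hr => hC.le_passingRate (h.2.1 r hr).2 hq (deriv ξ r)
  rw [intervalIntegral.integral_sub intervalIntegrable_const hi,
    intervalIntegral.integral_mul_const, h.integral_deriv] at hle
  simp only [intervalIntegral.integral_const, smul_eq_mul] at hle
  unfold pathCost
  linarith

lemma pathCost_add (hC : C.IsValid) (hD : D.IsValid C) (h : C.IsPath ξ s t x) {r : ℝ}
    (hsr : s ≤ r) (hrt : r ≤ t) :
    C.pathCost ξ s r + C.pathCost ξ r t = C.pathCost ξ s t :=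
  intervalIntegral.integral_add_adjacent_intervals
    ((h.mono le_rfl hrt).intervalIntegrable hC hD hsr)
    ((h.mono hsr le_rfl).intervalIntegrable hC hD hrt)

/-- Cost of a piece of a path with constant velocity. -/
lemma pathCost_le (hC : C.IsValid) (hD : D.IsValid C) (h : C.IsPath ξ s t x) (hst : s ≤ t)
    {u M : ℝ} (hu : ∀ r ∈ Ioo s t, deriv ξ r = u)
    (hM : ∀ r ∈ Ioo s t, C.passingRate (ξ r) u ≤ M) : C.pathCost ξ s t ≤ M * (t - s) := by
  have hle := intervalIntegral.integral_mono_on_of_le_Ioo hst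
    (h.intervalIntegrable hC hD hst) (intervalIntegrable_const (c := M))
    fun r hr => by rw [hu r hr]; exact hM r hr
  simp only [intervalIntegral.integral_const, smul_eq_mul] at hle
  unfold pathCost
  linarith

end IsPath

lemma pathCost_self (ξ : ℝ → ℝ) (t : ℝ) : C.pathCost ξ t t = 0 := intervalIntegral.integral_same

/-- The values of the observer paths that end at `x` at time `t`; their infimum is the cumulative
flow. -/
def pathValues (C : Corridor) (D : RushHour) (x t : ℝ) : Set ℝ :=
  {n | ∃ (s : ℝ) (ξ : ℝ → ℝ), 0 ≤ s ∧ s ≤ t ∧ C.IsPath ξ s t x ∧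
    ((s = 0 ∧ n = -(C.freeDensity D.qb * ξ 0) + C.pathCost ξ 0 t) ∨
      (ξ s = 0 ∧ n = D.cumulative s + C.pathCost ξ s t))}

lemma cumulativeFlow_eq (x t : ℝ) : C.cumulativeFlow D x t = sInf (C.pathValues D x t) := rfl

/-! ### The cumulative flow at the downstream end -/

lemma exitCount_le_of_mem_pathValues (hC : C.IsValid) (hD : D.IsValid C) {t n : ℝ}
    (hn : n ∈ C.pathValues D C.length t) : C.exitCount D t ≤ n := by
  obtain ⟨s, ξ, hs, hst, hξ, h⟩ := hn
  have hend : ξ t = C.length := hξ.2.2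
  rcases h with ⟨rfl, rfl⟩ | ⟨h0, rfl⟩
  · obtain ⟨q, hq, hle⟩ := exists_exitCount_le (D := D) hC hD hst
    have h1 := hξ.le_pathCost hC hD hst ⟨hD.qb_nonneg.trans hq.1, hq.2⟩
    have h2 := freeDensity_mono_exit hC hD.qb_nonneg hq.1 hq.2
    have h3 := (hξ.2.1 0 ⟨le_rfl, hst⟩).1
    rw [hend] at h1
    nlinarith [mul_le_mul_of_nonneg_right h2 h3]
  · obtain ⟨q, hq⟩ := exists_isOptimalFlow hC hD (t - s)
    have h1 := hξ.le_pathCost hC hD hst hq.1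
    have h2 := exitCount_le (D := D) hC hD (hs.trans hst) hst
    rw [countFrom, hq.2] at h2
    rw [hend, h0] at h1
    rw [hD.cumulative_eq hs]
    linarith

/-- The optimum in `crossingCost` is attained by travelling for a time `σ` and then waiting at the
downstream end. -/
lemma exists_travel_wait (hC : C.IsValid) (hD : D.IsValid C) {τ : ℝ} (hτ : 0 < τ) :
    ∃ σ q, 0 < σ ∧ σ ≤ τ ∧
      (∀ p ∈ Icc 0 C.capacity,
        σ * p - C.length * C.freeDensity p ≤ σ * q - C.length * C.freeDensity q) ∧
      C.crossingCost τ =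
        σ * q - C.length * C.freeDensity q + C.exitCapacity * (τ - σ) := by
  obtain ⟨q, hq, hq'⟩ := exists_isOptimalFlow hC hD τ
  have hmax : ∀ p ∈ Icc 0 C.exitCapacity,
      τ * p - C.length * C.freeDensity p ≤ τ * q - C.length * C.freeDensity q :=
    fun p hp => hq' ▸ le_crossingCost hC hD hp τ
  have hval : C.crossingCost τ =
      τ * q - C.length * C.freeDensity q + C.exitCapacity * (τ - τ) := by rw [hq']; ring
  have hcc := hC.exitCapacity_le_capacity
  rcases hq.2.lt_or_eq with hlt | rfl
  · exact ⟨τ, q, hτ, le_rfl, fun p hp => hC.optimal_of_lt hcc hq.1 hlt hmax hp, hval⟩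
  rcases hcc.lt_or_eq with hlt | heq
  · obtain ⟨τ', hτ', hopt⟩ := hC.exists_travelTime ⟨hq.1, hlt⟩
    rcases le_total τ τ' with hle | hle
    · refine ⟨τ, _, hτ, le_rfl, fun p hp => ?_, hval⟩
      rcases le_total p C.exitCapacity with hp' | hp'
      · exact hmax p ⟨hp.1, hp'⟩
      · nlinarith [hopt p hp]
    · refine ⟨τ', _, ?_, hle, hopt, ?_⟩
      · have h1 := hopt 0 ⟨le_rfl, hq.1.trans hcc⟩
        have h2 := hC.freeDensity_strictMonoOn ⟨le_rfl, hq.1.trans hcc⟩ ⟨hq.1, hcc⟩ (exit_pos hD)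
        rw [hC.freeDensity_zero] at h1 h2
        have := mul_pos hC.length_pos h2
        have h3 : 0 < τ' * C.exitCapacity := by linarith
        exact pos_of_mul_pos_left h3 hq.1
      · rw [hq']; ring
  · exact ⟨τ, _, hτ, le_rfl, fun p hp => hmax p (heq ▸ hp), hval⟩

lemma exists_pathValue_le_countFrom (hC : C.IsValid) (hD : D.IsValid C) {s t : ℝ} (hs : 0 ≤ s)
    (hst : s < t) : ∃ n ∈ C.pathValues D C.length t, n ≤ C.countFrom D t s := by
  obtain ⟨σ, q, hσ, hστ, hopt, hval⟩ := exists_travel_wait hC hD (sub_pos.2 hst)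
  have hl := hC.length_pos
  set u := C.length / σ with hu
  have hu0 : 0 < u := div_pos hl hσ
  have huσ : u * σ = C.length := div_mul_cancel₀ _ hσ.ne'
  set ξ : ℝ → ℝ := fun r => min C.length (u * (r - s)) with hξdef
  have hlate : ∀ r, s + σ ≤ r → ξ r = C.length := fun r hr => by
    refine min_eq_left ?_
    rw [← huσ]
    exact mul_le_mul_of_nonneg_left (by linarith) hu0.le
  have hξ : C.IsPath ξ s t C.length := by
    refine ⟨⟨⟨u, hu0.le⟩, LipschitzWith.of_le_add_mul _ fun x y => ?_⟩, fun r hr => ?_,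
      hlate t (by linarith)⟩
    · have h1 : u * (x - y) ≤ u * dist x y := mul_le_mul_of_nonneg_left (le_abs_self _) hu0.le
      have h2 : 0 ≤ u * dist x y := by positivity
      change min _ _ ≤ min _ _ + u * dist x y
      rw [← min_add_add_right]
      exact le_min ((min_le_left _ _).trans (by linarith)) ((min_le_right _ _).trans (by linarith))
    · exact ⟨le_min hl.le (mul_nonneg hu0.le (sub_nonneg.2 hr.1)), min_le_left _ _⟩
  refine ⟨_, ⟨s, ξ, hs, hst.le, hξ, Or.inr ⟨by simp [hξdef, hl.le], rfl⟩⟩, ?_⟩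
  have h1 : C.pathCost ξ s (s + σ) ≤ (q - u * C.freeDensity q) * (s + σ - s) := by
    refine (hξ.mono le_rfl (by linarith)).pathCost_le hC hD (by linarith) (u := u)
      (fun r hr => ?_) fun r _ => hC.passingRate_le hu0.le fun p hp => ?_
    · have hev : ξ =ᶠ[nhds r] fun w => u * (w - s) := by
        filter_upwards [Iio_mem_nhds hr.2] with w hw
        refine min_eq_right ?_
        rw [← huσ]
        exact mul_le_mul_of_nonneg_left (by linarith [mem_Iio.1 hw]) hu0.le
      rw [hev.deriv_eq]
      simp
    · have h := hopt p hp
      rw [← huσ] at h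
      have h' : σ * (p - u * C.freeDensity p) ≤ σ * (q - u * C.freeDensity q) := by linarith
      exact le_of_mul_le_mul_left h' hσ
  have h2 : C.pathCost ξ (s + σ) t ≤ C.exitCapacity * (t - (s + σ)) := by
    refine (hξ.mono (by linarith) le_rfl).pathCost_le hC hD (by linarith) (u := 0)
      (fun r hr => ?_) fun r hr => ?_
    · have hev : ξ =ᶠ[nhds r] fun _ => C.length := by
        filter_upwards [Ioi_mem_nhds hr.1] with w hw
        exact hlate w hw.le
      rw [hev.deriv_eq]; simp
    · rw [hlate r hr.1.le]
      exact hC.passingRate_zero_le _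
  have h3 := hξ.pathCost_add hC hD (show s ≤ s + σ by linarith) (show s + σ ≤ t by linarith)
  have h4 : (q - u * C.freeDensity q) * (s + σ - s) = σ * q - C.length * C.freeDensity q := by
    rw [← huσ]; ring
  rw [hD.cumulative_eq hs, countFrom, hval]
  linarith

/-- Until the first wave from the upstream end arrives, the initial flow leaves the link. -/
lemma exists_pathValue_le_initial (hC : C.IsValid) (hD : D.IsValid C) {τ t : ℝ} (ht : 0 ≤ t)
    (htτ : t ≤ τ)
    (hopt : ∀ p ∈ Icc 0 C.capacity,
      τ * p - C.length * C.freeDensity p ≤ τ * D.qb - C.length * C.freeDensity D.qb) :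
    ∃ n ∈ C.pathValues D C.length t, n ≤ D.qb * t - C.length * C.freeDensity D.qb := by
  have hl := hC.length_pos
  set u := C.length / τ with hu
  have hu0 : 0 ≤ u := div_nonneg hl.le (ht.trans htτ)
  set ξ : ℝ → ℝ := fun r => C.length + u * (r - t) with hξdef
  have hut : u * t ≤ C.length := by
    rcases (ht.trans htτ).eq_or_lt with h | h
    · have : t = 0 := le_antisymm (h ▸ htτ) ht
      rw [this, mul_zero]; exact hl.le
    · rw [hu, div_mul_eq_mul_div, div_le_iff₀ h]
      exact mul_le_mul_of_nonneg_left htτ hl.le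
  have hξ : C.IsPath ξ 0 t C.length := by
    refine ⟨⟨⟨u, hu0⟩, LipschitzWith.of_le_add_mul _ fun x y => ?_⟩, fun r hr => ?_, ?_⟩
    · have h1 : u * (x - y) ≤ u * dist x y := mul_le_mul_of_nonneg_left (le_abs_self _) hu0
      change _ ≤ _ + u * dist x y
      simp only [hξdef]
      linarith
    · constructor
      · simp only [hξdef]; nlinarith [mul_nonneg hu0 hr.1]
      · simp only [hξdef]; nlinarith [mul_nonneg hu0 (sub_nonneg.2 hr.2)]
    · simp [hξdef]
  refine ⟨_, ⟨0, ξ, le_rfl, ht, hξ, Or.inl ⟨rfl, rfl⟩⟩, ?_⟩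
  have hcost : C.pathCost ξ 0 t ≤ (D.qb - u * C.freeDensity D.qb) * (t - 0) := by
    rcases ht.eq_or_lt with rfl | htpos
    · simp [pathCost_self]
    have hτ : 0 < τ := htpos.trans_le htτ
    have huτ : u * τ = C.length := div_mul_cancel₀ _ hτ.ne'
    refine hξ.pathCost_le hC hD ht (u := u) (fun r hr => ?_) fun r _ =>
      hC.passingRate_le hu0 fun p hp => ?_
    · simp [hξdef]
    · have h := hopt p hp
      rw [← huτ] at h
      have h' : τ * (p - u * C.freeDensity p) ≤ τ * (D.qb - u * C.freeDensity D.qb) := by linarith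
      exact le_of_mul_le_mul_left h' hτ
  simp only [hξdef]
  linarith

/-- The cumulative flow at the downstream end is the infimal convolution of demand and
`crossingCost`. -/
lemma cumulativeFlow_length (hC : C.IsValid) (hD : D.IsValid C) {t : ℝ} (ht : 0 ≤ t) :
    C.cumulativeFlow D C.length t = C.exitCount D t := by
  have hbdd : BddBelow (C.pathValues D C.length t) :=
    ⟨C.exitCount D t, fun n hn => exitCount_le_of_mem_pathValues hC hD hn⟩
  obtain ⟨τ, hτ, hoptb, hopt⟩ := exists_travelTime_optimal hC ⟨hD.qb_nonneg, hD.qb_lt_exit⟩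
  have hne : (C.pathValues D C.length t).Nonempty := by
    rcases ht.eq_or_lt with rfl | ht'
    · obtain ⟨n, hn, -⟩ := exists_pathValue_le_initial hC hD le_rfl hτ hopt
      exact ⟨n, hn⟩
    · obtain ⟨n, hn, -⟩ := exists_pathValue_le_countFrom (D := D) hC hD le_rfl ht'
      exact ⟨n, hn⟩
  refine le_antisymm ?_ (le_csInf hne fun n hn => exitCount_le_of_mem_pathValues hC hD hn)
  rw [cumulativeFlow_eq]
  suffices h : ∀ s ≤ t, sInf (C.pathValues D C.length t) ≤ C.countFrom D t s by
    obtain ⟨s, hs⟩ := exists_entryTime (D := D) hC hD ht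
    exact exitCount_eq hs ▸ h s hs.1
  have hlt : ∀ s, 0 ≤ s → s < t →
      sInf (C.pathValues D C.length t) ≤ C.countFrom D t s := fun s hs hst => by
    obtain ⟨n, hn, hle⟩ := exists_pathValue_le_countFrom hC hD hs hst
    exact (csInf_le hbdd hn).trans hle
  have hinit : t ≤ τ →
      sInf (C.pathValues D C.length t) ≤ D.qb * t - C.length * C.freeDensity D.qb := fun htτ => by
    obtain ⟨n, hn, hle⟩ := exists_pathValue_le_initial hC hD ht htτ hopt
    exact (csInf_le hbdd hn).trans hle
  have hle : ∀ s, 0 ≤ s → s ≤ t →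
      sInf (C.pathValues D C.length t) ≤ C.countFrom D t s := fun s hs hst => by
    rcases hst.lt_or_eq with h | rfl
    · exact hlt s hs h
    rcases hs.eq_or_lt with rfl | hpos
    · rw [countFrom_self hC hD, D.arrivals_zero]
      have hK := mul_nonneg hC.length_pos.le (hC.freeDensity_nonneg
        ⟨hD.qb_nonneg, hD.qb_lt_exit.le.trans hC.exitCapacity_le_capacity⟩)
      linarith [hinit hτ]
    · have hcont : Continuous (C.countFrom D s) :=
        (continuous_countFrom hC hD).comp (Continuous.prodMk_right s)
      refine ge_of_tendsto (hcont.continuousWithinAt (s := Iio s) (x := s)) ?_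
      filter_upwards [Ico_mem_nhdsLT hpos] with r hr
      exact hlt r hr.1 hr.2
  intro s hst
  rcases le_total 0 s with hs | hs
  · exact hle s hs hst
  rcases le_total t τ with htτ | hτt
  · have h1 := le_crossingCost hC hD hoptb.1 (t - s)
    rw [countFrom, hD.arrivals_of_nonpos hs]
    linarith [hinit htτ]
  · -- an observer who leaves before time `0` is not better off than one who leaves at time `0`
    obtain ⟨q, hq⟩ := exists_isOptimalFlow hC hD t
    have h1 := le_crossingCost hC hD hq.1 (t - s)
    have h2 := le_crossingCost hC hD hoptb.1 (t - s)
    have h3 := le_crossingCost hC hD hq.1 τ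
    have h4 := hle 0 le_rfl ht
    rw [hoptb.2] at h3
    rw [countFrom, D.arrivals_zero, sub_zero, hq.2] at h4
    rw [countFrom, hD.arrivals_of_nonpos hs]
    rcases le_total D.qb q with hqb | hqb
    · nlinarith
    · nlinarith

end Corridor

/-! ### The cumulative flow at the upstream end -/

namespace Corridor

variable {C : Corridor} {D : RushHour}

lemma pathValues_zero_nonneg (hC : C.IsValid) (hD : D.IsValid C) {t n : ℝ}
    (hn : n ∈ C.pathValues D 0 t) : 0 ≤ n := by
  obtain ⟨s, ξ, hs, hst, hξ, h⟩ := hn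
  have hend : ξ t = 0 := hξ.2.2
  have hb : D.qb ∈ Icc 0 C.exitCapacity := ⟨hD.qb_nonneg, hD.qb_lt_exit.le⟩
  have h1 := hξ.le_pathCost hC hD hst hb
  have h4 := mul_nonneg hD.qb_nonneg (sub_nonneg.2 hst)
  rcases h with ⟨rfl, rfl⟩ | ⟨h0, rfl⟩
  · rw [hend] at h1
    linarith
  · have h2 : 0 ≤ D.arrivals s := by simpa [D.arrivals_zero] using hD.arrivals_mono hs
    rw [hend, h0] at h1
    rw [hD.cumulative_eq hs]
    linarith

lemma bddBelow_pathValues_zero (hC : C.IsValid) (hD : D.IsValid C) (t : ℝ) :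
    BddBelow (C.pathValues D 0 t) := ⟨0, fun _ hn => pathValues_zero_nonneg hC hD hn⟩

lemma arrivals_mem_pathValues (hC : C.IsValid) (hD : D.IsValid C) {t : ℝ} (ht : 0 ≤ t) :
    D.arrivals t ∈ C.pathValues D 0 t := by
  refine ⟨t, fun _ => 0, ht, le_rfl, ⟨⟨0, LipschitzWith.const _⟩,
    fun _ _ => ⟨le_rfl, hC.length_pos.le⟩, rfl⟩, Or.inr ⟨rfl, ?_⟩⟩
  rw [hD.cumulative_eq ht, pathCost_self, add_zero]

lemma cumulativeFlow_zero_le (hC : C.IsValid) (hD : D.IsValid C) {t : ℝ} (ht : 0 ≤ t) :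
    C.cumulativeFlow D 0 t ≤ D.arrivals t :=
  csInf_le (bddBelow_pathValues_zero hC hD t) (arrivals_mem_pathValues hC hD ht)

lemma le_cumulativeFlow_zero (hC : C.IsValid) (hD : D.IsValid C) {t y : ℝ} (ht : 0 ≤ t)
    (h : ∀ n ∈ C.pathValues D 0 t, y ≤ n) : y ≤ C.cumulativeFlow D 0 t :=
  le_csInf ⟨_, arrivals_mem_pathValues hC hD ht⟩ h

/-- An observer can extend the path by waiting at the upstream end. -/
lemma cumulativeFlow_zero_le_add (hC : C.IsValid) (hD : D.IsValid C) {t u : ℝ} (ht : 0 ≤ t)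
    (htu : t ≤ u) :
    C.cumulativeFlow D 0 u ≤ C.cumulativeFlow D 0 t + C.capacity * (u - t) := by
  rw [← sub_le_iff_le_add]
  refine le_cumulativeFlow_zero hC hD ht fun n hn => ?_
  rw [sub_le_iff_le_add]
  obtain ⟨s, ξ, hs, hst, hξ, h⟩ := hn
  have hend : ξ t = 0 := hξ.2.2
  obtain ⟨K, hK⟩ := hξ.1
  set ζ : ℝ → ℝ := fun r => ξ (min r t) with hζdef
  have hζ : C.IsPath ζ s u 0 := by
    refine ⟨⟨K * 1, hK.comp (LipschitzWith.id.min_const t)⟩, fun r hr => ?_, ?_⟩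
    · exact hξ.2.1 _ ⟨le_min hr.1 hst, min_le_right _ _⟩
    · simp [hζdef, min_eq_right htu, hend]
  have h1 : C.pathCost ζ s t = C.pathCost ξ s t := by
    refine intervalIntegral.integral_congr_ae ?_
    have hne : ∀ᵐ r : ℝ, r ≠ t := by simp [ae_iff]
    filter_upwards [hne] with r hrt hr
    rw [uIoc_of_le hst] at hr
    have hlt : r < t := lt_of_le_of_ne hr.2 hrt
    have hev : ζ =ᶠ[nhds r] ξ := by
      filter_upwards [Iio_mem_nhds hlt] with w hw
      simp [hζdef, min_eq_left (mem_Iio.1 hw).le]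
    rw [hev.deriv_eq, hev.eq_of_nhds]
  have h2 : C.pathCost ζ t u ≤ C.capacity * (u - t) := by
    have hzero : ∀ r, t ≤ r → ζ r = 0 := fun r hr => by simp [hζdef, min_eq_right hr, hend]
    refine (hζ.mono hst le_rfl).pathCost_le hC hD htu (u := 0) (fun r hr => ?_) fun r hr => ?_
    · have hev : ζ =ᶠ[nhds r] fun _ => 0 := by
        filter_upwards [Ioi_mem_nhds hr.1] with w hw
        exact hzero w (mem_Ioi.1 hw).le
      rw [hev.deriv_eq]; simp
    · rw [hzero r hr.1.le]
      exact (hC.passingRate_zero_le _).trans (hC.localCapacity_le_capacity hC.length_pos.le)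
  have h3 := hζ.pathCost_add hC hD hst htu
  have hstart : ζ s = ξ s := by simp [hζdef, min_eq_left hst]
  rcases h with ⟨rfl, rfl⟩ | ⟨h0, rfl⟩
  · refine (csInf_le (bddBelow_pathValues_zero hC hD u)
      ⟨0, ζ, le_rfl, ht.trans htu, hζ, Or.inl ⟨rfl, rfl⟩⟩).trans ?_
    rw [hstart]; linarith
  · refine (csInf_le (bddBelow_pathValues_zero hC hD u)
      ⟨s, ζ, hs, hst.trans htu, hζ, Or.inr ⟨hstart.trans h0, rfl⟩⟩).trans ?_
    linarith

/-- Cutting a loop of duration `h` out of a path that returns to the same position. -/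
lemma exists_shortened_path (hC : C.IsValid) (hD : D.IsValid C) {ξ : ℝ → ℝ} {s t r h x : ℝ}
    (hξ : C.IsPath ξ s (t + h) x) (hsr : s ≤ r) (hrt : r ≤ t) (hh : 0 ≤ h)
    (hloop : ξ (r + h) = ξ r) :
    ∃ ζ, C.IsPath ζ s t x ∧ ζ s = ξ s ∧
      C.pathCost ζ s t + C.exitCapacity * h ≤ C.pathCost ξ s (t + h) := by
  have hst := hsr.trans hrt
  obtain ⟨K, hK⟩ := hξ.1
  set ζ : ℝ → ℝ := fun w => ξ (min w r) + (ξ (max w r + h) - ξ r) with hζdef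
  have hleft : ∀ w, w ≤ r → ζ w = ξ w := fun w hw => by
    simp [hζdef, min_eq_left hw, max_eq_right hw, hloop]
  have hright : ∀ w, r ≤ w → ζ w = ξ (w + h) := fun w hw => by
    simp [hζdef, min_eq_right hw, max_eq_left hw]
  have hζ : C.IsPath ζ s t x := by
    refine ⟨⟨K * 1 + (K * (1 + 0) + 0), (hK.comp (LipschitzWith.id.min_const r)).add
      ((hK.comp ((LipschitzWith.id.max_const r).add (LipschitzWith.const h))).sub
        (LipschitzWith.const _))⟩, fun w hw => ?_, ?_⟩
    · rcases le_total w r with hwr | hwr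
      · rw [hleft w hwr]; exact hξ.2.1 w ⟨hw.1, by linarith [hw.2]⟩
      · rw [hright w hwr]; exact hξ.2.1 _ ⟨by linarith [hw.1], by linarith [hw.2]⟩
    · rw [hright t hrt]; exact hξ.2.2
  refine ⟨ζ, hζ, hleft s hsr, ?_⟩
  have hne : ∀ᵐ w : ℝ, w ≠ r := by simp [ae_iff]
  have h1 : C.pathCost ζ s r = C.pathCost ξ s r := by
    refine intervalIntegral.integral_congr_ae ?_
    filter_upwards [hne] with w hwr hw
    rw [uIoc_of_le hsr] at hw
    have hev : ζ =ᶠ[nhds w] ξ := by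
      filter_upwards [Iio_mem_nhds (lt_of_le_of_ne hw.2 hwr)] with v hv
      exact hleft v (mem_Iio.1 hv).le
    rw [hev.deriv_eq, hev.eq_of_nhds]
  have h2 : C.pathCost ζ r t = C.pathCost ξ (r + h) (t + h) := by
    unfold pathCost
    rw [← intervalIntegral.integral_comp_add_right]
    refine intervalIntegral.integral_congr_ae ?_
    refine Filter.Eventually.of_forall fun w hw => ?_
    rw [uIoc_of_le hrt] at hw
    have hev : ζ =ᶠ[nhds w] fun v => ξ (v + h) := by
      filter_upwards [Ioi_mem_nhds hw.1] with v hv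
      exact hright v (mem_Ioi.1 hv).le
    rw [hev.deriv_eq, hev.eq_of_nhds, deriv_comp_add_const]
  have h3 := (hξ.mono (u := r) (v := r + h) hsr (by linarith)).le_pathCost hC hD (by linarith)
    (right_mem_Icc.2 (exit_mem hC hD).1)
  rw [hloop] at h3
  have h4 := hζ.pathCost_add hC hD hsr hrt
  have h5 := hξ.pathCost_add hC hD hsr (show r ≤ t + h by linarith)
  have h6 := (hξ.mono hsr le_rfl).pathCost_add hC hD (show r ≤ r + h by linarith)
    (show r + h ≤ t + h by linarith)
  linarith

lemma shift_path {ξ : ℝ → ℝ} {t h x : ℝ}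
    (hξ : C.IsPath ξ 0 (t + h) x) (hh : 0 ≤ h) :
    C.IsPath (fun r => ξ (r + h)) 0 t x ∧
      C.pathCost (fun r => ξ (r + h)) 0 t = C.pathCost ξ h (t + h) := by
  obtain ⟨K, hK⟩ := hξ.1
  refine ⟨⟨⟨K * (1 + 0), hK.comp (LipschitzWith.id.add (LipschitzWith.const h))⟩,
    fun r hr => hξ.2.1 _ ⟨by linarith [hr.1], by linarith [hr.2]⟩, hξ.2.2⟩, ?_⟩
  unfold pathCost
  simp only [deriv_comp_add_const]
  rw [intervalIntegral.integral_comp_add_right (fun r => C.passingRate (ξ r) (deriv ξ r)),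
    zero_add]

/-- The flow at the upstream end is at least the exit capacity, except as far as demand is
exhausted: a piece of duration `u - t` can be cut out of every path that starts before `t`. -/
lemma pathValues_zero_cut (hC : C.IsValid) (hD : D.IsValid C) {t u n : ℝ} (ht : 0 ≤ t)
    (htu : t ≤ u) (hn : n ∈ C.pathValues D 0 u) :
    (∃ s ∈ Icc t u, D.arrivals s + C.exitCapacity * (u - s) ≤ n) ∨
      C.cumulativeFlow D 0 t + C.exitCapacity * (u - t) ≤ n := by
  obtain ⟨h, rfl⟩ : ∃ h, u = t + h := ⟨u - t, by ring⟩
  have hh : 0 ≤ h := by linarith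
  have hc := right_mem_Icc.2 (exit_mem hC hD).1
  have hbdd := bddBelow_pathValues_zero hC hD t
  obtain ⟨s, ξ, hs, hst, hξ, hval⟩ := hn
  have hend : ξ (t + h) = 0 := hξ.2.2
  rw [add_sub_cancel_left]
  rcases le_total t s with hts | hts
  · rcases hval with ⟨rfl, rfl⟩ | ⟨h0, rfl⟩
    · -- only `t = s = 0` is left, which is the trivial shift
      obtain rfl : t = 0 := le_antisymm hts ht
      refine Or.inl ⟨0, ⟨le_rfl, hst⟩, ?_⟩
      have h1 := hξ.le_pathCost hC hD hst hc
      have h2 := freeDensity_mono_exit hC hD.qb_nonneg hD.qb_lt_exit.le le_rfl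
      have h3 := (hξ.2.1 0 ⟨le_rfl, hst⟩).1
      rw [hend] at h1
      rw [D.arrivals_zero]
      nlinarith [mul_le_mul_of_nonneg_right h2 h3]
    · refine Or.inl ⟨s, ⟨hts, hst⟩, ?_⟩
      have h1 := hξ.le_pathCost hC hD hst hc
      rw [hend, h0] at h1
      rw [hD.cumulative_eq hs]
      linarith
  · right
    -- if the path has advanced during the first `h`, it has a loop of duration `h` since it returns
    -- to `0`; otherwise it starts at time `0`, and dropping the first `h` leaves a path from there
    by_cases hstart : ξ s ≤ ξ (s + h)
    · have hcont : ContinuousOn (fun r => ξ (r + h) - ξ r) (Icc s t) := by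
        have := hξ.continuous
        fun_prop
      have hmem : (0 : ℝ) ∈ Icc (ξ (t + h) - ξ t) (ξ (s + h) - ξ s) := by
        have := (hξ.2.1 t ⟨hts, by linarith⟩).1
        constructor <;> linarith
      obtain ⟨r, hr, hr0⟩ := intermediate_value_Icc' hts hcont hmem
      obtain ⟨ζ, hζ, hζs, hcost⟩ := exists_shortened_path hC hD hξ hr.1 hr.2 hh (by
        simp only at hr0; linarith)
      rcases hval with ⟨rfl, rfl⟩ | ⟨h0, rfl⟩
      · have := csInf_le hbdd ⟨0, ζ, le_rfl, ht, hζ, Or.inl ⟨rfl, rfl⟩⟩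
        rw [hζs] at this
        rw [cumulativeFlow_eq]; linarith
      · have := csInf_le hbdd ⟨s, ζ, hs, hts, hζ, Or.inr ⟨hζs.trans h0, rfl⟩⟩
        rw [cumulativeFlow_eq]; linarith
    · rw [not_le] at hstart
      rcases hval with ⟨rfl, rfl⟩ | ⟨h0, rfl⟩
      · rw [zero_add] at hstart
        obtain ⟨hζ, hcost⟩ := shift_path hξ hh
        have h1 := csInf_le hbdd ⟨0, _, le_rfl, ht, hζ, Or.inl ⟨rfl, rfl⟩⟩
        have h2 := (hξ.mono (u := 0) (v := h) le_rfl (by linarith)).le_pathCost hC hD hh hc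
        have h3 := hξ.pathCost_add hC hD hh (show h ≤ t + h by linarith)
        have h4 := freeDensity_mono_exit hC hD.qb_nonneg hD.qb_lt_exit.le le_rfl
        rw [hcost] at h1
        simp only [zero_add] at h1
        rw [cumulativeFlow_eq]
        nlinarith [mul_le_mul_of_nonneg_right h4 (sub_nonneg.2 hstart.le)]
      · rw [h0] at hstart
        exact absurd (hξ.2.1 (s + h) ⟨by linarith, by linarith⟩).1 (not_le.2 hstart)

/-- Lower bounds for path values at the upstream end, in terms of an entry time `s` of the
downstream end at the same time `t`. A path that starts before the wave from `s` to `(length, t)`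
has to cross this wave; up to the crossing it cannot do better than the wave. -/
lemma pathValues_zero_cases (hC : C.IsValid) (hD : D.IsValid C) {t s n : ℝ} (ht : 0 ≤ t)
    (hs : s ∈ C.entryTimes D t) (hn : n ∈ C.pathValues D 0 t) :
    (∃ r, 0 ≤ r ∧ s ≤ r ∧ r ≤ t ∧ D.arrivals r + C.exitCapacity * (t - r) ≤ n) ∨
    (∃ θ ∈ Icc (0 : ℝ) 1, D.arrivals s + θ * (D.demand s * (t - s)) +
        (1 - θ) * (C.exitCapacity * (t - s)) +
        θ * C.length * (C.freeDensity C.exitCapacity - C.freeDensity (D.demand s)) ≤ n) ∨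
    (s ≤ 0 ∧ C.exitCapacity * t ≤ n) := by
  obtain ⟨r, ξ, hr, hrt, hξ, hval⟩ := hn
  have hst := hs.1
  have hend : ξ t = 0 := hξ.2.2
  have hc := right_mem_Icc.2 (exit_mem hC hD).1
  have hopt := isOptimalFlow_of_mem_entryTimes hC hD hs
  have hF := exitCount_eq_of_mem hC hD hs
  -- paths that start before `s` meet the wave at some fraction `θ` of its way
  have hcross : r ≤ s → ∃ θ ∈ Icc (0 : ℝ) 1, ξ (s + θ * (t - s)) = θ * C.length := fun hrs => by
    rcases hst.eq_or_lt with heq | hlt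
    · exact ⟨0, ⟨le_rfl, zero_le_one⟩, by simp [heq, hend]⟩
    have hcont : ContinuousOn (fun θ => ξ (s + θ * (t - s)) - θ * C.length) (Icc 0 1) := by
      have := hξ.continuous
      fun_prop
    have hmem : (0 : ℝ) ∈ Icc (ξ (s + 1 * (t - s)) - 1 * C.length)
        (ξ (s + 0 * (t - s)) - 0 * C.length) := by
      have h1 := (hξ.2.1 s ⟨hrs, hst⟩).1
      have h2 : s + 1 * (t - s) = t := by ring
      rw [h2, hend]
      constructor
      · linarith [hC.length_pos]
      · simpa using h1
    obtain ⟨θ, hθ, h0⟩ := intermediate_value_Icc' zero_le_one hcont hmem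
    exact ⟨θ, hθ, by simp only at h0; linarith⟩
  have hmeet : ∀ θ ∈ Icc (0 : ℝ) 1, s ≤ s + θ * (t - s) ∧ s + θ * (t - s) ≤ t := fun θ hθ => by
    have h1 := mul_nonneg hθ.1 (sub_nonneg.2 hst)
    have h2 := mul_nonneg (sub_nonneg.2 hθ.2) (sub_nonneg.2 hst)
    constructor <;> nlinarith
  -- the bound before the crossing, from the optimality of the wave at the downstream end
  have halg : ∀ θ ∈ Icc (0 : ℝ) 1, ∀ q ∈ Icc 0 C.exitCapacity, ∀ y,
      C.exitCount D t ≤ y + (q * (t - r) - C.length * C.freeDensity q) →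
      D.arrivals s + θ * (D.demand s * (t - s) - C.length * C.freeDensity (D.demand s)) ≤
        y + (q * (s + θ * (t - s) - r) - C.freeDensity q * (θ * C.length)) := by
    intro θ hθ q hq y hy
    have h1 := le_crossingCost hC hD hq (t - s)
    rw [hopt.2] at h1
    rw [hF] at hy
    nlinarith [mul_le_mul_of_nonneg_left h1 (sub_nonneg.2 hθ.2)]
  rcases hval with ⟨rfl, rfl⟩ | ⟨h0, rfl⟩
  · rcases le_total s 0 with hs0 | hs0
    · right; right
      refine ⟨hs0, ?_⟩
      have h1 := hξ.le_pathCost hC hD hrt hc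
      have h2 := freeDensity_mono_exit hC hD.qb_nonneg hD.qb_lt_exit.le le_rfl
      have h3 := (hξ.2.1 0 ⟨le_rfl, hrt⟩).1
      rw [hend] at h1
      nlinarith [mul_le_mul_of_nonneg_right h2 h3]
    · right; left
      obtain ⟨θ, hθ, hx⟩ := hcross hs0
      obtain ⟨hm1, hm2⟩ := hmeet θ hθ
      refine ⟨θ, hθ, ?_⟩
      obtain ⟨q, hq, hle⟩ := exists_exitCount_le (D := D) hC hD ht
      have hq' : q ∈ Icc 0 C.exitCapacity := ⟨hD.qb_nonneg.trans hq.1, hq.2⟩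
      have h1 := halg θ hθ q hq' 0 (by linarith)
      have h2 := (hξ.mono (u := 0) (v := s + θ * (t - s)) le_rfl hm2).le_pathCost hC hD
        (hs0.trans hm1) hq'
      have h3 := (hξ.mono (u := s + θ * (t - s)) (hs0.trans hm1) le_rfl).le_pathCost hC hD hm2 hc
      have h4 := hξ.pathCost_add hC hD (hs0.trans hm1) hm2
      have h5 := freeDensity_mono_exit hC hD.qb_nonneg hq.1 hq.2
      have h6 := mul_le_mul_of_nonneg_right h5 (hξ.2.1 0 ⟨le_rfl, hrt⟩).1
      rw [hend, hx] at h3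
      rw [hx] at h2
      nlinarith
  · rw [hD.cumulative_eq hr]
    rcases le_total s r with hsr | hrs
    · left
      refine ⟨r, hr, hsr, hrt, ?_⟩
      have h1 := hξ.le_pathCost hC hD hrt hc
      rw [hend, h0] at h1
      linarith
    · right; left
      obtain ⟨θ, hθ, hx⟩ := hcross hrs
      obtain ⟨hm1, hm2⟩ := hmeet θ hθ
      refine ⟨θ, hθ, ?_⟩
      obtain ⟨q, hq⟩ := exists_isOptimalFlow hC hD (t - r)
      have hle := exitCount_le (D := D) hC hD ht hrt
      rw [countFrom, hq.2] at hle
      have h1 := halg θ hθ q hq.1 (D.arrivals r) (by linarith)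
      have h2 := (hξ.mono (u := r) (v := s + θ * (t - s)) le_rfl hm2).le_pathCost hC hD
        (hrs.trans hm1) hq.1
      have h3 := (hξ.mono (u := s + θ * (t - s)) (hrs.trans hm1) le_rfl).le_pathCost hC hD hm2 hc
      have h4 := hξ.pathCost_add hC hD (hrs.trans hm1) hm2
      rw [hend, hx] at h3
      rw [hx, h0] at h2
      nlinarith

end Corridor

/-! ### Accumulation -/

namespace Corridor

variable {C : Corridor} {D : RushHour}

lemma le_cumulativeFlow_zero_of_cut (hC : C.IsValid) (hD : D.IsValid C) {t u y : ℝ} (ht : 0 ≤ t)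
    (htu : t ≤ u) (h1 : y ≤ C.cumulativeFlow D 0 t + C.exitCapacity * (u - t))
    (h2 : ∀ s ∈ Icc t u, y ≤ D.arrivals s + C.exitCapacity * (u - s)) :
    y ≤ C.cumulativeFlow D 0 u := by
  refine le_cumulativeFlow_zero hC hD (ht.trans htu) fun n hn => ?_
  rcases pathValues_zero_cut hC hD ht htu hn with ⟨s, hs, h⟩ | h
  · exact (h2 s hs).trans h
  · exact h1.trans h

lemma cumulativeFlow_zero_mono (hC : C.IsValid) (hD : D.IsValid C) {t u : ℝ} (ht : 0 ≤ t)
    (htu : t ≤ u) : C.cumulativeFlow D 0 t ≤ C.cumulativeFlow D 0 u := by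
  have hc := (exit_mem hC hD).1
  refine le_cumulativeFlow_zero_of_cut hC hD ht htu
    (le_add_of_nonneg_right (mul_nonneg hc (sub_nonneg.2 htu))) fun s hs => ?_
  exact ((cumulativeFlow_zero_le hC hD ht).trans (hD.arrivals_mono hs.1)).trans
    (le_add_of_nonneg_right (mul_nonneg hc (sub_nonneg.2 hs.2)))

lemma continuousOn_cumulativeFlow_zero (hC : C.IsValid) (hD : D.IsValid C) :
    ContinuousOn (C.cumulativeFlow D 0) (Ici 0) := by
  have hc : 0 ≤ C.capacity := (exit_mem hC hD).1.trans (exit_mem hC hD).2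
  refine (LipschitzOnWith.of_le_add_mul ⟨C.capacity, hc⟩ fun x hx y hy => ?_).continuousOn
  rw [Real.dist_eq]
  rcases le_total x y with h | h
  · exact (cumulativeFlow_zero_mono hC hD hx h).trans (le_add_of_nonneg_right (by positivity))
  · rw [abs_of_nonneg (sub_nonneg.2 h)]
    exact cumulativeFlow_zero_le_add hC hD hy h

lemma accumulation_eq (hC : C.IsValid) (hD : D.IsValid C) {t : ℝ} (ht : 0 ≤ t) :
    C.accumulation D t = C.cumulativeFlow D 0 t - C.exitCount D t := by
  rw [accumulation, cumulativeFlow_length hC hD ht]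

lemma continuousOn_accumulation (hC : C.IsValid) (hD : D.IsValid C) :
    ContinuousOn (C.accumulation D) (Ici 0) :=
  ((continuousOn_cumulativeFlow_zero hC hD).sub (continuousOn_exitCount hC hD)).congr
    fun _ ht => accumulation_eq hC hD ht

lemma exitCount_hasDeriv_cumulativeFlow (hC : C.IsValid) (hD : D.IsValid C) {t : ℝ}
    (ht : 0 ≤ t) :
    HasDerivWithinAt (fun r => C.cumulativeFlow D C.length r) (C.exitRate D t) (Ici t) t :=
  (exitCount_hasDeriv hC hD ht).congr (fun _ hr => cumulativeFlow_length hC hD (ht.trans hr))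
    (cumulativeFlow_length hC hD ht)

lemma exitFlow_eq (hC : C.IsValid) (hD : D.IsValid C) {t : ℝ} (ht : 0 ≤ t) :
    C.exitFlow D t = C.exitRate D t :=
  (exitCount_hasDeriv_cumulativeFlow hC hD ht).derivWithin (uniqueDiffWithinAt_Ici t)

/-- The demand stays below a level once it has fallen below it. -/
lemma demand_le_of_demand_lt (hD : D.IsValid C) {s r v : ℝ} (hsr : s ≤ r) (hrv : r ≤ v)
    (h : D.demand r < D.demand s) : D.demand v ≤ D.demand r := by
  have h1 := (hD.toff_lt_of_demand_lt hsr h).le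
  exact hD.demand_anti h1 (h1.trans hrv) hrv

/-- Inflow up to time `t`: either the demand has been served, or the link holds at least as many
vehicles as in uncongested traffic with the flow that belongs to the entry time `s`. -/
lemma min_le_cumulativeFlow_zero (hC : C.IsValid) (hD : D.IsValid C) {t s : ℝ} (ht : 0 ≤ t)
    (hs : s ∈ C.entryTimes D t) :
    min (D.arrivals t) (D.arrivals s + D.demand s * (t - s)) ≤ C.cumulativeFlow D 0 t := by
  have hq := (isOptimalFlow_of_mem_entryTimes hC hD hs).1
  have hst := sub_nonneg.2 hs.1
  refine le_cumulativeFlow_zero hC hD ht fun n hn => ?_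
  rcases pathValues_zero_cases hC hD ht hs hn with ⟨r, hr0, hsr, hrt, h⟩ | ⟨θ, hθ, h⟩ | ⟨hs0, h⟩
  · have h1 := mul_le_mul_of_nonneg_right hq.2 (sub_nonneg.2 hrt)
    rcases le_or_gt (D.demand s) (D.demand r) with hle | hlt
    · have h2 := D.le_arrivals_sub (q := D.demand s) hsr fun v hv =>
        (le_min le_rfl hle).trans (hD.min_le_demand hv.1 hv.2)
      exact (min_le_right _ _).trans (by linarith)
    · have h2 := D.arrivals_sub_le (q := D.demand s) hrt fun v hv =>
        (demand_le_of_demand_lt hD hsr hv.1 hlt).trans hlt.le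
      exact (min_le_left _ _).trans (by linarith)
  · have h1 := mul_le_mul_of_nonneg_right hq.2 hst
    have h2 := mul_le_mul_of_nonneg_left h1 (sub_nonneg.2 hθ.2)
    have h3 := freeDensity_mono_exit hC hq.1 hq.2 le_rfl
    have h4 := mul_nonneg (mul_nonneg hθ.1 hC.length_pos.le) (sub_nonneg.2 h3)
    exact (min_le_right _ _).trans (by linarith)
  · have h1 := mul_le_mul_of_nonneg_right hD.qb_lt_exit.le ht
    rw [hD.demand_of_nonpos hs0, hD.arrivals_of_nonpos hs0]
    exact (min_le_right _ _).trans (by linarith)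

/-- During falling demand the link holds at most as many vehicles as in uncongested traffic with
the flow that belongs to the entry time. -/
lemma accumulation_le_of_toff_le (hC : C.IsValid) (hD : D.IsValid C) {t s : ℝ} (ht : 0 ≤ t)
    (hs : s ∈ C.entryTimes D t) (hoff : D.toff ≤ s) :
    C.accumulation D t ≤ C.length * C.freeDensity (D.demand s) := by
  have h1 := cumulativeFlow_zero_le hC hD ht
  have h2 := D.arrivals_sub_le (q := D.demand s) hs.1 fun v hv =>
    hD.demand_anti hoff (hoff.trans hv.1) hv.1
  rw [accumulation_eq hC hD ht, exitCount_eq_of_mem hC hD hs]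
  linarith

lemma accumulation_lt_of_toff_le (hC : C.IsValid) (hD : D.IsValid C) {t s : ℝ} (ht : 0 ≤ t)
    (hs : s ∈ C.entryTimes D t) (hoff : D.toff ≤ s) (hne : D.demand s ≠ D.qe) :
    C.accumulation D t < C.length * C.freeDensity (D.demand s) := by
  have h1 := cumulativeFlow_zero_le hC hD ht
  have hst : s < t := by
    refine lt_of_le_of_ne hs.1 fun h => hne ?_
    subst h
    have h0 := demand_eq_zero_of_self_mem hC hD hs
    have := hD.qe_le_demand hoff
    have := hD.qe_nonneg
    linarith
  have h2 := D.arrivals_sub_lt (q := D.demand s) hst fun v hv =>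
    hD.demand_lt_of_fall hv.1 hoff hne
  rw [accumulation_eq hC hD ht, exitCount_eq_of_mem hC hD hs]
  linarith

/-- The demand up to time `t` has entered the link, so that there is no queue upstream of it, and
the inflow is below the exit flow. -/
def Emptying (C : Corridor) (D : RushHour) (t : ℝ) : Prop :=
  C.cumulativeFlow D 0 t = D.arrivals t ∧ D.demand t < C.exitRate D t

/-- Either the link is at least as full as in uncongested traffic with the present exit flow, or
it is emptying. -/
lemma accumulation_dichotomy (hC : C.IsValid) (hD : D.IsValid C) {t : ℝ} (ht : 0 ≤ t) :
    C.length * C.freeDensity (C.exitRate D t) ≤ C.accumulation D t ∨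
      C.Emptying D t := by
  obtain ⟨s, hs, hse, -⟩ := exists_entryTime_exitRate (D := D) hC hD ht
  have h1 := min_le_cumulativeFlow_zero hC hD ht hs
  have h2 := cumulativeFlow_zero_le hC hD ht
  rw [accumulation_eq hC hD ht, exitCount_eq_of_mem hC hD hs, ← hse]
  rcases le_or_gt (D.demand s) (D.demand t) with hle | hlt
  · left
    have h3 := D.le_arrivals_sub (q := D.demand s) hs.1 fun v hv =>
      (le_min le_rfl hle).trans (hD.min_le_demand hv.1 hv.2)
    rw [min_eq_right (by linarith)] at h1
    linarith
  · rcases min_le_iff.1 h1 with h | h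
    · exact Or.inr ⟨le_antisymm h2 h, hse ▸ hlt⟩
    · left; linarith

lemma Emptying.later (hC : C.IsValid) (hD : D.IsValid C) {t u : ℝ} (ht : 0 ≤ t)
    (h : C.Emptying D t) (htu : t ≤ u) :
    C.cumulativeFlow D 0 u = D.arrivals u ∧ D.demand u ≤ C.exitRate D u := by
  obtain ⟨s, hs, hse, -⟩ := exists_entryTime_exitRate (D := D) hC hD ht
  have hdec : ∀ v, t ≤ v → D.demand v ≤ D.demand t := fun v hv =>
    demand_le_of_demand_lt hD hs.1 hv (hse ▸ h.2)
  have hcap := (exitRate_mem (D := D) hC hD ht).2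
  have hle : ∀ v, t ≤ v → D.demand v ≤ C.exitCapacity := fun v hv =>
    (hdec v hv).trans (h.2.le.trans hcap)
  refine ⟨le_antisymm (cumulativeFlow_zero_le hC hD (ht.trans htu))
    (le_cumulativeFlow_zero_of_cut hC hD ht htu ?_ fun r hr => ?_), ?_⟩
  · have := D.arrivals_sub_le htu fun v hv => hle v hv.1
    rw [h.1]; linarith
  · have := D.arrivals_sub_le hr.2 fun v hv => hle v (hr.1.trans hv.1)
    linarith
  · obtain ⟨r, hr, hre, -⟩ := exists_entryTime_exitRate (D := D) hC hD (ht.trans htu)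
    by_contra hcon
    rw [not_le] at hcon
    have hlt : D.demand r < C.exitRate D t := by
      rw [hre]; exact hcon.trans_le ((hdec u htu).trans h.2.le)
    have hsr := entryTime_le_of_demand_lt hC hD ht htu hs hr hlt
    have h3 := hD.min_le_demand hsr hr.1
    rw [hse, hre] at h3
    exact h3.not_gt (lt_min (hre ▸ hlt) hcon)

lemma Emptying.accumulation_eq (hC : C.IsValid) (hD : D.IsValid C) {t u : ℝ} (ht : 0 ≤ t)
    (h : C.Emptying D t) (htu : t ≤ u) :
    C.accumulation D u = D.arrivals u - C.exitCount D u := by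
  rw [Corridor.accumulation_eq hC hD (ht.trans htu), (h.later hC hD ht htu).1]

lemma hasDeriv_arrivals_sub_exitCount (hC : C.IsValid) (hD : D.IsValid C) {t : ℝ} (ht : 0 ≤ t) :
    HasDerivWithinAt (fun r => D.arrivals r - C.exitCount D r)
      (D.demand t - C.exitRate D t) (Ici t) t :=
  (D.hasDerivAt_arrivals t).hasDerivWithinAt.sub (exitCount_hasDeriv hC hD ht)

lemma Emptying.antitoneOn (hC : C.IsValid) (hD : D.IsValid C) {t : ℝ} (ht : 0 ≤ t)
    (h : C.Emptying D t) : AntitoneOn (C.accumulation D) (Ici t) := by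
  intro u hu v hv huv
  rw [h.accumulation_eq hC hD ht hu, h.accumulation_eq hC hD ht hv]
  have hsub : Icc u v ⊆ Ici 0 := fun r hr => (ht.trans hu).trans hr.1
  refine image_le_of_deriv_right_le_deriv_boundary (a := u) (b := v)
    (f := fun r => D.arrivals r - C.exitCount D r) (f' := fun r => D.demand r - C.exitRate D r)
    (B := fun _ => D.arrivals u - C.exitCount D u) (B' := fun _ => 0)
    (D.continuous_arrivals.continuousOn.sub ((continuousOn_exitCount hC hD).mono hsub))
    (fun r hr => hasDeriv_arrivals_sub_exitCount hC hD (hsub (Ico_subset_Icc_self hr))) le_rfl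
    continuousOn_const (fun r _ => hasDerivWithinAt_const _ _ _) (fun r hr => ?_)
    (right_mem_Icc.2 huv)
  have := (h.later hC hD ht (le_trans (mem_Ici.1 hu) hr.1)).2
  linarith

lemma Emptying.accumulation_lt (hC : C.IsValid) (hD : D.IsValid C) {t u : ℝ} (ht : 0 ≤ t)
    (h : C.Emptying D t) (htu : t < u) : C.accumulation D u < C.accumulation D t := by
  have hd := (hasDeriv_arrivals_sub_exitCount (D := D) hC hD ht).Ioi_of_Ici
  rw [hasDerivWithinAt_iff_tendsto_slope' (by simp)] at hd
  have hev := (hd.eventually_lt_const (sub_neg.2 h.2)).and (Ioc_mem_nhdsGT htu)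
  obtain ⟨v, hv, hv'⟩ := hev.exists
  rw [slope_def_field, div_lt_iff₀ (sub_pos.2 hv'.1), zero_mul,
    ← h.accumulation_eq hC hD ht hv'.1.le, ← h.accumulation_eq hC hD ht le_rfl] at hv
  exact (h.antitoneOn hC hD ht hv'.1.le htu.le hv'.2).trans_lt (sub_neg.1 hv)

/-! ### Counter-clockwise hysteresis -/

lemma freeDensity_lt_exit (hC : C.IsValid) {p q : ℝ} (hp : 0 ≤ p) (hpq : p < q)
    (hq : q ≤ C.exitCapacity) : C.length * C.freeDensity p < C.length * C.freeDensity q := by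
  have := hC.exitCapacity_le_capacity
  exact mul_lt_mul_of_pos_left
    (hC.freeDensity_strictMonoOn ⟨hp, by linarith⟩ ⟨by linarith, by linarith⟩ hpq) hC.length_pos

/-- A lower exit flow at a later time means fewer vehicles on the link. -/
lemma accumulation_lt_of_exitRate_lt (hC : C.IsValid) (hD : D.IsValid C) {t u : ℝ} (ht : 0 ≤ t)
    (htu : t < u) (h : C.exitRate D u < C.exitRate D t) :
    C.accumulation D u < C.accumulation D t := by
  have hu := ht.trans htu.le
  rcases accumulation_dichotomy (D := D) hC hD ht with h1 | h1
  · obtain ⟨r, hr, hre, -⟩ := exists_entryTime_exitRate (D := D) hC hD hu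
    have h2 := toff_lt_of_exitRate_lt hC hD ht htu.le hr (hre ▸ h)
    have h3 := accumulation_le_of_toff_le hC hD hu hr h2.le
    have h4 := freeDensity_lt_exit hC (exitRate_mem (D := D) hC hD hu).1 h
      (exitRate_mem (D := D) hC hD ht).2
    rw [hre] at h3
    linarith
  · exact h1.accumulation_lt hC hD ht htu

/-- If the exit flow equals the end flow already while demand is rising, the link holds more
vehicles than in uncongested traffic with that flow. -/
lemma lt_accumulation_of_rise (hC : C.IsValid) (hD : D.IsValid C) {t s : ℝ} (ht : 0 < t)
    (hs : s ∈ C.entryTimes D t) (hoff : s ≤ D.toff) (hse : D.demand s = D.qe)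
    (hqe : D.qe < C.exitCapacity) :
    C.length * C.freeDensity D.qe < C.accumulation D t := by
  have hsp : D.demand s < D.qp := hse ▸ hD.qe_lt_qp
  have hst : s < t := by
    refine lt_of_le_of_ne hs.1 fun h => ?_
    subst h
    have h0 := demand_eq_zero_of_self_mem hC hD hs
    have h1 := hD.demand_lt_of_rise ht ht hoff
      (by rw [hD.demand_of_nonpos le_rfl]; exact hD.qb_lt_qp)
    rw [hD.demand_of_nonpos le_rfl, h0] at h1
    exact h1.not_ge hD.qb_nonneg
  have hsoff : s < D.toff := by
    refine lt_of_le_of_ne hoff fun h => ?_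
    rw [h, hD.demand_toff] at hsp
    exact lt_irrefl _ hsp
  have hge : ∀ v, s ≤ v → D.qe ≤ D.demand v := fun v hv => by
    rcases le_total v D.toff with h | h
    · exact hse ▸ hD.demand_mono hoff h hv
    · exact hD.qe_le_demand h
  -- the demand exceeds the end flow on `(max s 0, w)`
  obtain ⟨w, hw1, hw2⟩ := exists_between (show max s 0 < min t D.toff from
    max_lt (lt_min hst hsoff) (lt_min ht hD.toff_pos))
  have hsw : s < w := (le_max_left _ _).trans_lt hw1
  have hwt : w < t := hw2.trans_le (min_le_left _ _)
  have hgain : D.qe * (w - s) < D.arrivals w - D.arrivals s := by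
    have h1 := D.le_arrivals_sub (le_max_left s 0) fun v hv => hge v hv.1
    have h2 := D.lt_arrivals_sub (q := D.qe) hw1 fun v hv => by
      rw [← hse]
      exact hD.demand_lt_of_rise ((le_max_left _ _).trans_lt hv.1)
        ((le_max_right _ _).trans_lt hv.1) (hv.2.le.trans (hw2.le.trans (min_le_right _ _))) hsp
    linarith
  have hcq : 0 < C.exitCapacity - D.qe := sub_pos.2 hqe
  have hKq := freeDensity_lt_exit hC hD.qe_nonneg hqe le_rfl
  -- a gain that every path value has, whichever of the lower bounds applies to it
  obtain ⟨δ, hδ, hδ1, hδ2, hδ3, hδ4, hδ5⟩ : ∃ δ > 0,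
      δ ≤ D.arrivals w - D.arrivals s - D.qe * (w - s) ∧
      δ ≤ (C.exitCapacity - D.qe) * (t - w) ∧ δ ≤ (C.exitCapacity - D.qe) * (t - s) ∧
      δ ≤ C.length * C.freeDensity C.exitCapacity - C.length * C.freeDensity D.qe ∧
      δ ≤ (C.exitCapacity - D.qe) * t := by
    refine ⟨min (D.arrivals w - D.arrivals s - D.qe * (w - s))
      (min ((C.exitCapacity - D.qe) * (t - w)) (min ((C.exitCapacity - D.qe) * (t - s))
      (min (C.length * C.freeDensity C.exitCapacity - C.length * C.freeDensity D.qe)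
        ((C.exitCapacity - D.qe) * t)))), ?_, ?_⟩
    · refine lt_min (by linarith) (lt_min (mul_pos hcq (by linarith)) (lt_min
        (mul_pos hcq (by linarith)) (lt_min (by linarith) (mul_pos hcq ht))))
    · simp only [min_le_iff, le_refl, true_or, or_true, and_true]
  have hN : D.arrivals s + D.qe * (t - s) + δ ≤ C.cumulativeFlow D 0 t := by
    refine le_cumulativeFlow_zero hC hD ht.le fun n hn => ?_
    rcases pathValues_zero_cases hC hD ht.le hs hn with
      ⟨r, hr0, hsr, hrt, h⟩ | ⟨θ, hθ, h⟩ | ⟨hs0, h⟩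
    · rcases le_total r w with hrw | hwr
      · have h1 := D.le_arrivals_sub hsr fun v hv => hge v hv.1
        nlinarith
      · have h1 := D.le_arrivals_sub hwr fun v hv => hge v (hsw.le.trans hv.1)
        nlinarith
    · rw [hse] at h
      nlinarith [mul_le_mul_of_nonneg_left hδ3 (sub_nonneg.2 hθ.2),
        mul_le_mul_of_nonneg_left hδ4 hθ.1]
    · have h1 : D.qe = D.qb := by rw [← hse, hD.demand_of_nonpos hs0]
      rw [hD.arrivals_of_nonpos hs0, ← h1]
      linarith
  rw [accumulation_eq hC hD ht.le, exitCount_eq_of_mem hC hD hs, hse]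
  linarith

lemma exitRate_lt_or_eq (hC : C.IsValid) (hD : D.IsValid C) {t u : ℝ} (ht : 0 < t) (htu : t < u)
    (hA : C.accumulation D t = C.accumulation D u) :
    C.exitRate D t < C.exitRate D u ∨ ∀ v ∈ Icc t u, C.exitRate D v = C.exitRate D t := by
  by_contra hcon
  push Not at hcon
  obtain ⟨hle, v, hv, hvne⟩ := hcon
  have hu := ht.trans htu
  have hv0 := ht.trans_le hv.1
  have hPeq : C.exitRate D t = C.exitRate D u := by
    refine le_antisymm ?_ hle
    by_contra h
    exact (accumulation_lt_of_exitRate_lt hC hD ht.le htu (not_le.1 h)).ne' hA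
  have hvgt : C.exitRate D t < C.exitRate D v := by
    have h := min_le_exitRate (D := D) hC hD ht.le hv.1 hv.2
    rw [← hPeq, min_self] at h
    exact lt_of_le_of_ne h (Ne.symm hvne)
  obtain ⟨r, hr, hre, -⟩ := exists_entryTime_exitRate (D := D) hC hD hu.le
  have hroff := toff_lt_of_exitRate_lt hC hD hv0.le hv.2 hr (by rw [hre, ← hPeq]; exact hvgt)
  rcases accumulation_dichotomy (D := D) hC hD ht.le with h1 | h1
  · by_cases hq : D.demand r = D.qe
    · obtain ⟨s, hs, hse, -⟩ := exists_entryTime_exitRate (D := D) hC hD ht.le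
      obtain ⟨p, hp, hpe, -⟩ := exists_entryTime_exitRate (D := D) hC hD hv0.le
      have hsp := le_entryTime_of_demand_lt hC hD ht.le hv.1 hs hp (hse.trans_lt hvgt)
      have hsoff := hD.lt_toff_of_demand_lt hsp (by rw [hse, hpe]; exact hvgt)
      have hsq : D.demand s = D.qe := by rw [hse, hPeq, ← hre, hq]
      have h2 := lt_accumulation_of_rise hC hD ht hs hsoff.le hsq
        (by rw [← hsq, hse]; exact hvgt.trans_le (exitRate_mem hC hD hv0.le).2)
      have h3 := accumulation_le_of_toff_le hC hD hu.le hr hroff.le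
      rw [hq] at h3
      linarith
    · have h3 := accumulation_lt_of_toff_le hC hD hu.le hr hroff.le hq
      rw [hre, ← hPeq] at h3
      linarith
  · exact (h1.accumulation_lt hC hD ht.le htu).ne' hA

lemma isCounterclockwise (hC : C.IsValid) (hD : D.IsValid C) :
    IsCounterclockwise (C.accumulation D) (C.exitFlow D) := by
  refine ⟨fun t u ht htu hA => ?_, fun t u ht htu hA => ?_⟩
  · rw [exitFlow_eq hC hD ht, exitFlow_eq hC hD (ht.trans htu.le)]
    by_contra h
    exact (accumulation_lt_of_exitRate_lt hC hD ht htu (not_le.1 h)).ne' hA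
  · rw [exitFlow_eq hC hD ht.le, exitFlow_eq hC hD (ht.trans htu).le]
    refine (exitRate_lt_or_eq hC hD ht htu hA).imp_right fun h v hv => ?_
    rw [exitFlow_eq hC hD (ht.le.trans hv.1)]
    exact h v hv

end Corridor

/-! ### Saturation -/

namespace Corridor

variable {C : Corridor} {D : RushHour}

lemma withoutBottleneck_isValid (hC : C.IsValid) : C.withoutBottleneck.IsValid where
  length_pos := hC.length_pos
  x0_mem := hC.x0_mem
  jam_pos := hC.jam_pos
  concave := hC.concave
  continuous := hC.continuous
  Q_zero := hC.Q_zero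
  Q_jam := hC.Q_jam
  qbn_antitone := fun _ _ _ _ _ => le_rfl
  qbn_start := rfl

lemma withoutBottleneck_exitCapacity : C.withoutBottleneck.exitCapacity = C.capacity := by
  unfold exitCapacity localCapacity
  split_ifs <;> rfl

lemma isValid_withoutBottleneck (hC : C.IsValid) (hD : D.IsValid C) :
    D.IsValid C.withoutBottleneck where
  a_pos := hD.a_pos
  b_pos := hD.b_pos
  qb_nonneg := hD.qb_nonneg
  qe_nonneg := hD.qe_nonneg
  qb_lt_qp := hD.qb_lt_qp
  qe_lt_qp := hD.qe_lt_qp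
  peak_le_toff := hD.peak_le_toff
  qp_le_capacity := hD.qp_le_capacity
  qb_lt_exit := by
    rw [withoutBottleneck_exitCapacity]
    exact hD.qb_lt_exit.trans_le hC.exitCapacity_le_capacity

/-- While a queue is active the exit flow is at capacity, because a wave whose flow is below the
exit capacity is not affected by the bottleneck. -/
lemma exitRate_of_queueActive (hC : C.IsValid) (hD : D.IsValid C) {t : ℝ} (ht : 0 ≤ t)
    (h : C.QueueActive D t) : C.exitRate D t = C.exitCapacity := by
  have hC' := withoutBottleneck_isValid hC
  have hD' := isValid_withoutBottleneck hC hD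
  obtain ⟨s, hs, hse, -⟩ := exists_entryTime_exitRate (D := D) hC hD ht
  refine le_antisymm (exitRate_mem hC hD ht).2 (not_lt.1 fun hlt => h.not_ge ?_)
  have hopt := isOptimalFlow_of_mem_entryTimes hC hD hs
  have hq : D.demand s < C.exitCapacity := hse ▸ hlt
  have hopt' : C.withoutBottleneck.IsOptimalFlow (t - s) (D.demand s) := by
    refine isOptimalFlow_of_forall ?_ fun p hp => ?_
    · rw [withoutBottleneck_exitCapacity]
      exact ⟨hopt.1.1, hq.le.trans hC.exitCapacity_le_capacity⟩
    · rw [withoutBottleneck_exitCapacity] at hp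
      exact hC.optimal_of_lt hC.exitCapacity_le_capacity hopt.1.1 hq
        (fun p hp => hopt.2 ▸ le_crossingCost hC hD hp _) hp
  have h1 := cumulativeFlow_length hC' hD' ht
  have h2 := exitCount_le hC' hD' ht hs.1
  rw [countFrom, hopt'.2, ← h1] at h2
  have h3 := exitCount_eq hs
  rw [countFrom, hopt.2, ← cumulativeFlow_length hC hD ht] at h3
  rw [h3]
  exact h2

lemma mem_saturatedTimes (hC : C.IsValid) (hD : D.IsValid C) {t : ℝ} :
    t ∈ C.saturatedTimes D ↔ 0 ≤ t ∧ C.exitRate D t = C.exitCapacity :=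
  and_congr_right fun ht => by rw [exitFlow_eq hC hD ht]

lemma ordConnected_saturatedTimes (hC : C.IsValid) (hD : D.IsValid C) :
    (C.saturatedTimes D).OrdConnected := by
  refine ⟨fun t ht u hu v hv => ?_⟩
  rw [mem_saturatedTimes hC hD] at *
  have hv0 := ht.1.trans hv.1
  refine ⟨hv0, le_antisymm (exitRate_mem hC hD hv0).2 ?_⟩
  have h := min_le_exitRate (D := D) hC hD ht.1 hv.1 hv.2
  rwa [ht.2, hu.2, min_self] at h

/-- A lower bound for the exit rate right after `t` holds at `t`. -/
lemma le_exitRate_of_forall_Ioo (hC : C.IsValid) (hD : D.IsValid C) {t u q : ℝ} (ht : 0 ≤ t)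
    (htu : t < u) (h : ∀ v ∈ Ioo t u, q ≤ C.exitRate D v) : q ≤ C.exitRate D t := by
  have hF := continuousOn_exitCount (D := D) hC hD
  have hinc : ∀ w z, t < w → w < z → z < u →
      q * (z - w) ≤ C.exitCount D z - C.exitCount D w := fun w z hw hwz hz => by
    have hsub : Icc w z ⊆ Ici 0 := fun r hr => ht.trans (hw.le.trans hr.1)
    have := image_le_of_deriv_right_le_deriv_boundary (a := w) (b := z)
      (f := fun r => q * (r - w) + C.exitCount D w) (f' := fun _ => q)
      (B := C.exitCount D) (B' := C.exitRate D) (by fun_prop)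
      (fun r _ => by
        simpa using ((((hasDerivAt_id r).sub_const w).const_mul q).add_const
          (C.exitCount D w)).hasDerivWithinAt)
      (by simp) (hF.mono hsub)
      (fun r hr => exitCount_hasDeriv hC hD (hsub (Ico_subset_Icc_self hr)))
      (fun r hr => h r ⟨hw.trans_le hr.1, hr.2.trans hz⟩) (right_mem_Icc.2 hwz.le)
    linarith
  have hd := (exitCount_hasDeriv (D := D) hC hD ht).Ioi_of_Ici
  rw [hasDerivWithinAt_iff_tendsto_slope' (by simp)] at hd
  refine ge_of_tendsto hd ?_
  filter_upwards [Ioo_mem_nhdsGT htu] with z hz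
  rw [slope_def_field, le_div_iff₀ (sub_pos.2 hz.1)]
  have hlim : Filter.Tendsto (fun w => C.exitCount D z - C.exitCount D w - q * (z - w))
      (nhdsWithin t (Ioi t)) (nhds (C.exitCount D z - C.exitCount D t - q * (z - t))) := by
    have h1 : ContinuousWithinAt (C.exitCount D) (Ioi t) t :=
      (hF t ht).mono fun w hw => ht.trans (mem_Ioi.1 hw).le
    have h2 : ContinuousWithinAt (fun w => q * (z - w)) (Ioi t) t := by fun_prop
    exact (continuousWithinAt_const.sub h1).sub h2
  have hpos := ge_of_tendsto (b := 0) hlim (by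
    filter_upwards [Ioo_mem_nhdsGT hz.1] with w hw
    linarith [hinc w z hw.1 hw.2 hz.2])
  linarith

/-- After a long time the link carries uncongested traffic with the end flow. -/
lemma exists_steady (hC : C.IsValid) (hD : D.IsValid C) (hqe : D.qe < C.exitCapacity) :
    ∃ T, 0 ≤ T ∧ ∀ t, T ≤ t → C.exitRate D t = D.qe ∧
      C.accumulation D t = C.length * C.freeDensity D.qe := by
  obtain ⟨T, hT, h⟩ := exists_entryTimes_late hC hD hqe
  refine ⟨T, hT, fun t ht => ?_⟩
  have ht0 := hT.trans ht
  obtain ⟨s, hs, hse, -⟩ := exists_entryTime_exitRate (D := D) hC hD ht0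
  obtain ⟨hoff, hdem⟩ := h t ht s hs
  refine ⟨hse ▸ hdem, le_antisymm (hdem ▸ accumulation_le_of_toff_le hC hD ht0 hs hoff) ?_⟩
  have h1 := min_le_cumulativeFlow_zero hC hD ht0 hs
  have h2 := D.le_arrivals_sub hs.1 fun v hv => hD.qe_le_demand (hoff.trans hv.1)
  rw [hdem, min_eq_right (by linarith)] at h1
  rw [accumulation_eq hC hD ht0, exitCount_eq_of_mem hC hD hs, hdem]
  linarith

lemma bddAbove_saturatedTimes (hC : C.IsValid) (hD : D.IsValid C)
    (hqe : D.qe < C.exitCapacity) : BddAbove (C.saturatedTimes D) := by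
  obtain ⟨T, -, h⟩ := exists_steady hC hD hqe
  refine ⟨T, fun t ht => ?_⟩
  by_contra hcon
  rw [mem_saturatedTimes hC hD, (h t (not_le.1 hcon).le).1] at ht
  exact hqe.ne ht.2

lemma accumulation_sSup_lt (hC : C.IsValid) (hD : D.IsValid C) (hqe : D.qe < C.exitCapacity)
    (hS : (C.saturatedTimes D).Nontrivial) :
    C.accumulation D (sSup (C.saturatedTimes D)) <
      C.accumulation D (sInf (C.saturatedTimes D)) := by
  have hmem : ∀ t, t ∈ C.saturatedTimes D ↔ 0 ≤ t ∧ C.exitRate D t = C.exitCapacity :=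
    fun t => mem_saturatedTimes hC hD
  have habove := bddAbove_saturatedTimes hC hD hqe
  have hbelow : BddBelow (C.saturatedTimes D) := ⟨0, fun t ht => ht.1⟩
  set a := sInf (C.saturatedTimes D) with ha
  set b := sSup (C.saturatedTimes D) with hb
  obtain ⟨x, hx, y, hy, hxy⟩ := hS.exists_lt
  have hab : a < b := ((csInf_le hbelow hx).trans_lt hxy).trans_le (le_csSup habove hy)
  have ha0 : 0 ≤ a := le_csInf ⟨x, hx⟩ fun t ht => ht.1
  have hb0 := ha0.trans hab.le
  have hPa : C.exitRate D a = C.exitCapacity := by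
    refine le_antisymm (exitRate_mem hC hD ha0).2
      (le_exitRate_of_forall_Ioo hC hD ha0 hab fun v hv => ?_)
    obtain ⟨p, hp, hpv⟩ := exists_lt_of_csInf_lt ⟨x, hx⟩ hv.1
    obtain ⟨q, hq, hvq⟩ := exists_lt_of_lt_csSup ⟨x, hx⟩ hv.2
    exact (((hmem v).1 ((ordConnected_saturatedTimes hC hD).out hp hq ⟨hpv.le, hvq.le⟩)).2).ge
  rcases (exitRate_mem (D := D) hC hD hb0).2.lt_or_eq with hlt | hPb
  · exact accumulation_lt_of_exitRate_lt hC hD ha0 hab (hPa ▸ hlt)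
  -- after `b` the exit flow is lower, so that `b` has an entry time during falling demand
  obtain ⟨s, hs, hoff⟩ := exists_entryTime_mem_of_frequently (D := D) hC hD hb0
    (Z := Ici D.toff) isClosed_Ici fun δ hδ => by
      have hu0 : 0 ≤ b + δ / 2 := by positivity
      obtain ⟨s, hs, hse, -⟩ := exists_entryTime_exitRate (D := D) hC hD hu0
      refine ⟨b + δ / 2, by linarith, by linarith, s, hs, ?_⟩
      have hu : C.exitRate D (b + δ / 2) < C.exitRate D b := by
        rw [hPb]
        refine lt_of_le_of_ne (exitRate_mem hC hD hu0).2 fun h => ?_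
        have := le_csSup habove ((hmem _).2 ⟨hu0, h⟩)
        linarith
      exact (toff_lt_of_exitRate_lt hC hD hb0 (by linarith) hs (hse.trans_lt hu)).le
  have hdem : D.demand s = C.exitCapacity :=
    le_antisymm (demand_le_exit hC hD hs) (hPb ▸ exitRate_le hC hD hb0 hs)
  have h1 := accumulation_lt_of_toff_le hC hD hb0 hs hoff (by rw [hdem]; exact hqe.ne')
  rcases accumulation_dichotomy (D := D) hC hD ha0 with h2 | h2
  · rw [hPa] at h2
    rw [hdem] at h1
    exact h1.trans_le h2
  · exact h2.accumulation_lt hC hD ha0 hab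

/-! ### Rise and fall of the accumulation -/

/-- Unless the link is emptying, the accumulation does not decrease to first order. -/
lemma eventually_slope_neg_accumulation_lt (hC : C.IsValid) (hD : D.IsValid C) {t ε : ℝ}
    (ht : 0 ≤ t) (h : ¬ C.Emptying D t) (hε : 0 < ε) :
    ∀ᶠ u in nhdsWithin t (Ioi t), slope (fun r => -C.accumulation D r) t u < ε := by
  have hP := exitRate_mem (D := D) hC hD ht
  have hd := (exitCount_hasDeriv (D := D) hC hD ht).Ioi_of_Ici
  rw [hasDerivWithinAt_iff_tendsto_slope' (by simp)] at hd
  have h1 := hd.eventually_lt_const (show C.exitRate D t < C.exitRate D t + ε / 2 by linarith)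
  have h2 : ∃ δ > 0, ∀ u, t < u → u < t + δ →
      C.cumulativeFlow D 0 t + (C.exitRate D t - ε / 2) * (u - t) ≤ C.cumulativeFlow D 0 u := by
    have hfirst : ∀ u, t < u → C.cumulativeFlow D 0 t + (C.exitRate D t - ε / 2) * (u - t) ≤
        C.cumulativeFlow D 0 t + C.exitCapacity * (u - t) := fun u hu => by
      nlinarith [hP.2]
    rcases (cumulativeFlow_zero_le hC hD ht).lt_or_eq with hlt | heq
    · -- a queue has covered the upstream end: the inflow is not below the exit capacity
      have hc := exit_pos hD
      refine ⟨(D.arrivals t - C.cumulativeFlow D 0 t) / C.exitCapacity,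
        div_pos (sub_pos.2 hlt) hc, fun u hu huδ => ?_⟩
      have h3 : (u - t) * C.exitCapacity < D.arrivals t - C.cumulativeFlow D 0 t := by
        rw [← lt_div_iff₀ hc]; linarith
      refine le_cumulativeFlow_zero_of_cut hC hD ht hu.le (hfirst u hu) fun s hs => ?_
      have h4 := hD.arrivals_mono hs.1
      have h5 := mul_nonneg hc.le (sub_nonneg.2 hs.2)
      linarith [hfirst u hu]
    · have hge : C.exitRate D t ≤ D.demand t := not_lt.1 fun h' => h ⟨heq, h'⟩
      have hcont : ∀ᶠ w in nhds t, C.exitRate D t - ε / 2 < D.demand w :=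
        continuousAt_const.eventually_lt D.continuous_demand.continuousAt (by linarith)
      obtain ⟨δ, hδ, hball⟩ := Metric.eventually_nhds_iff.1 hcont
      refine ⟨δ, hδ, fun u hu huδ => ?_⟩
      refine le_cumulativeFlow_zero_of_cut hC hD ht hu.le (hfirst u hu) fun s hs => ?_
      have h3 := D.le_arrivals_sub (q := C.exitRate D t - ε / 2) hs.1 fun v hv =>
        (hball (by rw [Real.dist_eq, abs_of_nonneg (sub_nonneg.2 hv.1)]; linarith [hv.2, hs.2])).le
      rw [heq]
      nlinarith [hP.2, hs.2]
  obtain ⟨δ, hδ, h2⟩ := h2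
  filter_upwards [h1, Ioo_mem_nhdsGT (lt_add_of_pos_right t hδ)] with u hu1 hu
  have hut := sub_pos.2 hu.1
  have h3 := h2 u hu.1 hu.2
  rw [slope_def_field, div_lt_iff₀ hut] at hu1
  rw [slope_def_field, div_lt_iff₀ hut, accumulation_eq hC hD ht,
    accumulation_eq hC hD (ht.trans hu.1.le)]
  linarith

lemma risesThenFalls (hC : C.IsValid) (hD : D.IsValid C) (hqe : D.qe < C.exitCapacity) :
    RisesThenFalls (C.accumulation D) := by
  have hA := continuousOn_accumulation (D := D) hC hD
  set V : Set ℝ := {t | 0 ≤ t ∧ AntitoneOn (C.accumulation D) (Ici t)} with hV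
  obtain ⟨T, hT, hsteady⟩ := exists_steady hC hD hqe
  have hne : V.Nonempty := ⟨T, hT, fun u hu v hv _ => by
    rw [(hsteady u hu).2, (hsteady v hv).2]⟩
  have hbdd : BddBelow V := ⟨0, fun t ht => ht.1⟩
  have hinf : 0 ≤ sInf V := le_csInf hne fun t ht => ht.1
  refine ⟨sInf V, hinf, fun u hu v hv huv => ?_, ?_⟩
  · have hsub : Icc u v ⊆ Ici 0 := fun r hr => hu.1.trans hr.1
    have := image_le_of_liminf_slope_right_le_deriv_boundary (a := u) (b := v)
      (f := fun r => -C.accumulation D r) (hA.mono hsub).neg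
      (B := fun _ => -C.accumulation D u) (B' := fun _ => 0) le_rfl continuousOn_const
      (fun r _ => hasDerivWithinAt_const _ _ _) (fun r hr ε hε => ?_) (right_mem_Icc.2 huv)
    · simpa using this
    · have hr0 := hsub (Ico_subset_Icc_self hr)
      refine (eventually_slope_neg_accumulation_lt hC hD hr0 (fun h => ?_) hε).frequently
      exact (csInf_le hbdd ⟨hr0, h.antitoneOn hC hD hr0⟩).not_gt (hr.2.trans_le hv.2)
  · have hlate : ∀ u v, sInf V < u → u ≤ v → C.accumulation D v ≤ C.accumulation D u :=
      fun u v hu huv => by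
        obtain ⟨t, ht, htu⟩ := exists_lt_of_csInf_lt hne hu
        exact ht.2 htu.le (htu.le.trans huv) huv
    intro u hu v hv huv
    rcases (mem_Ici.1 hu).lt_or_eq with hlt | rfl
    · exact hlate u v hlt huv
    rcases huv.lt_or_eq with hlt | rfl
    · have h1 : ContinuousWithinAt (C.accumulation D) (Ioi (sInf V)) (sInf V) :=
        (hA _ hinf).mono fun w hw => hinf.trans (mem_Ioi.1 hw).le
      refine ge_of_tendsto h1 ?_
      filter_upwards [Ioo_mem_nhdsGT hlt] with w hw
      exact hlate w v hw.1 hw.2.le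
    · exact le_rfl

/-! ### Two branches at the same accumulation -/

lemma accumulation_zero (hC : C.IsValid) (hD : D.IsValid C) :
    C.accumulation D 0 = C.length * C.freeDensity D.qb := by
  have h1 := cumulativeFlow_zero_le hC hD le_rfl
  have h2 := le_cumulativeFlow_zero hC hD le_rfl fun n hn => pathValues_zero_nonneg hC hD hn
  rw [D.arrivals_zero] at h1
  rw [accumulation_eq hC hD le_rfl, exitCount_zero hC hD]
  linarith

/-- If the flow is higher at the end than at the beginning, then the final accumulation is reached
already during the onset, with a lower exit flow. -/
lemma exists_branches_of_qb_lt_qe (hC : C.IsValid) (hD : D.IsValid C)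
    (hqe : D.qe < C.exitCapacity) (hbe : D.qb < D.qe) :
    ∃ t u, 0 ≤ t ∧ t < u ∧ C.accumulation D t = C.accumulation D u ∧
      C.exitRate D t < C.exitRate D u := by
  obtain ⟨T, hT, hsteady⟩ := exists_steady hC hD hqe
  -- a wave with the end flow that starts while demand is rising
  obtain ⟨s, hs, hse⟩ := intermediate_value_Icc hD.toff_pos.le D.continuous_demand.continuousOn
    (show D.qe ∈ Icc (D.demand 0) (D.demand D.toff) by
      rw [hD.demand_of_nonpos le_rfl, hD.demand_toff]; exact ⟨hbe.le, hD.qe_lt_qp.le⟩)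
  have hs0 : 0 < s := by
    refine lt_of_le_of_ne hs.1 fun h => ?_
    rw [← h, hD.demand_of_nonpos le_rfl] at hse
    exact hbe.ne hse
  obtain ⟨τ, hτ, hopt, -⟩ := exists_travelTime_optimal hC ⟨hD.qe_nonneg, hqe⟩
  have hmem : s ∈ C.entryTimes D (s + τ) := by
    refine ⟨by linarith, fun r hr => ?_⟩
    have h1 := le_crossingCost hC hD hopt.1 (s + τ - r)
    have h2 : D.qe * (r - s) ≤ D.arrivals r - D.arrivals s := by
      rcases le_total s r with hsr | hrs
      · refine D.le_arrivals_sub hsr fun v hv => ?_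
        rcases le_total v D.toff with h | h
        · exact hse ▸ hD.demand_mono hs.2 h hv.1
        · exact hD.qe_le_demand h
      · have := D.arrivals_sub_le (q := D.qe) hrs fun v hv =>
          hse ▸ hD.demand_mono (hv.2.trans hs.2) hs.2 hv.2
        linarith
    rw [countFrom, countFrom, add_sub_cancel_left, hopt.2]
    linarith
  have hpos : 0 < s + τ := by linarith
  have hgt := lt_accumulation_of_rise hC hD hpos hmem hs.2 hse hqe
  have hlt : C.accumulation D 0 < C.length * C.freeDensity D.qe := by
    rw [accumulation_zero hC hD]
    exact freeDensity_lt_exit hC hD.qb_nonneg hbe hqe.le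
  obtain ⟨t, ht, htA⟩ := intermediate_value_Icc hpos.le
    ((continuousOn_accumulation (D := D) hC hD).mono fun r hr => hr.1) ⟨hlt.le, hgt.le⟩
  have ht0 : 0 < t := lt_of_le_of_ne ht.1 fun h => by rw [← h] at htA; exact hlt.ne htA
  set u := max T (s + τ) + 1 with hu
  have hTu : T ≤ u := by linarith [le_max_left T (s + τ)]
  have htu : t < u := by linarith [le_max_right T (s + τ), ht.2]
  obtain ⟨hPu, hAu⟩ := hsteady u hTu
  refine ⟨t, u, ht.1, htu, htA.trans hAu.symm, ?_⟩
  by_contra hcon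
  rw [not_lt] at hcon
  rcases hcon.lt_or_eq with h | h
  · have := accumulation_lt_of_exitRate_lt hC hD ht.1 htu h
    rw [htA, hAu] at this
    exact lt_irrefl _ this
  · obtain ⟨r, hr, hre, -⟩ := exists_entryTime_exitRate (D := D) hC hD ht.1
    have hrq : D.demand r = D.qe := by rw [hre, ← h, hPu]
    rcases le_or_gt r D.toff with hoff | hoff
    · exact (lt_accumulation_of_rise hC hD ht0 hr hoff hrq hqe).ne' htA
    · have h1 := (entryTimes_exchange hC hD ht.2 hr hmem (hs.2.trans hoff.le)).2
      have h2 := accumulation_le_of_toff_le hC hD hpos.le h1 hoff.le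
      rw [hrq] at h2
      exact h2.not_gt hgt

/-- If the flow at the end does not exceed the one at the beginning, a level slightly above the
initial accumulation is passed both during the onset and during the offset. -/
lemma exists_branches_of_qe_le_qb (hC : C.IsValid) (hD : D.IsValid C)
    (hqe : D.qe < C.exitCapacity) (hbe : D.qe ≤ D.qb) {t : ℝ} (ht : 0 ≤ t)
    (hA : C.accumulation D 0 < C.accumulation D t) (hP : D.qb < C.exitRate D t) :
    ∃ t₁ t₂, 0 ≤ t₁ ∧ t₁ < t₂ ∧ C.accumulation D t₁ = C.accumulation D t₂ ∧
      C.exitRate D t₁ < C.exitRate D t₂ := by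
  have hcont := continuousOn_accumulation (D := D) hC hD
  obtain ⟨T, hT, hsteady⟩ := exists_steady hC hD hqe
  -- the last time before `t` at which the accumulation does not exceed its initial value
  set Z : Set ℝ := Icc 0 t ∩ C.accumulation D ⁻¹' Iic (C.accumulation D 0) with hZ
  have hZc : IsCompact Z := isCompact_Icc.of_isClosed_subset
    ((hcont.mono fun r hr => hr.1).preimage_isClosed_of_isClosed isClosed_Icc isClosed_Iic)
    inter_subset_left
  have hz := hZc.sSup_mem ⟨0, ⟨le_rfl, ht⟩, mem_preimage.2 (mem_Iic.2 le_rfl)⟩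
  set z := sSup Z with hzdef
  have hz0 : 0 ≤ z := hz.1.1
  have hAz : C.accumulation D z ≤ C.accumulation D 0 := hz.2
  have hzt : z < t := lt_of_le_of_ne hz.1.2 fun h => by
    rw [h] at hAz; exact hAz.not_gt hA
  have hafter : ∀ r, z < r → r ≤ t → C.accumulation D 0 < C.accumulation D r := fun r hzr hrt => by
    by_contra hcon
    have : r ∈ Z := ⟨⟨hz0.trans hzr.le, hrt⟩, not_lt.1 hcon⟩
    exact (le_csSup hZc.bddAbove this).not_gt hzr
  have hAcont : ContinuousWithinAt (C.accumulation D) (Ioi z) z :=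
    (hcont z hz0).mono fun w hw => hz0.trans (mem_Ioi.1 hw).le
  have hAz' : C.accumulation D 0 = C.accumulation D z := by
    refine le_antisymm (ge_of_tendsto hAcont ?_) hAz
    filter_upwards [Ioo_mem_nhdsGT hzt] with w hw
    exact (hafter w hw.1 hw.2.le).le
  rcases lt_or_ge D.qb (C.exitRate D z) with hlt | hge
  · refine ⟨0, z, le_rfl, lt_of_le_of_ne hz0 fun h => ?_, hAz', by rwa [exitRate_zero hC hD]⟩
    rw [← h, exitRate_zero hC hD] at hlt
    exact lt_irrefl _ hlt
  -- soon after `z` both the accumulation and the exit flow are below their values at `t`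
  obtain ⟨y, hzy, hy⟩ : ∃ y > z, ∀ r ∈ Ioo z y,
      r < t ∧ C.accumulation D r < C.accumulation D t := by
    have hev := (hAcont.eventually_lt_const (hAz.trans_lt hA)).and (Ioo_mem_nhdsGT hzt)
    obtain ⟨y, hzy, hy⟩ := mem_nhdsGT_iff_exists_Ioo_subset.1 hev
    exact ⟨y, hzy, fun r hr => ⟨(hy hr).2.2, (hy hr).1⟩⟩
  obtain ⟨r, hr, hPr⟩ : ∃ r ∈ Ioo z y, C.exitRate D r < C.exitRate D t := by
    by_contra hcon
    push Not at hcon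
    exact (le_exitRate_of_forall_Ioo hC hD hz0 hzy hcon).not_gt (hge.trans_lt hP)
  obtain ⟨hrt, hAr⟩ := hy r hr
  have hAend : C.accumulation D (max t T) ≤ C.accumulation D 0 := by
    rw [(hsteady _ (le_max_right _ _)).2, accumulation_zero hC hD]
    exact mul_le_mul_of_nonneg_left (freeDensity_mono_exit hC hD.qe_nonneg hbe hD.qb_lt_exit.le)
      hC.length_pos.le
  obtain ⟨u, hu, huA⟩ := intermediate_value_Icc' (le_max_left t T)
    (hcont.mono fun w hw => ht.trans hw.1)
    ⟨hAend.trans (hafter r hr.1 hrt.le).le, hAr.le⟩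
  have hr0 : 0 < r := hz0.trans_lt hr.1
  refine ⟨r, u, hr0.le, hrt.trans_le hu.1, huA.symm, ?_⟩
  refine (exitRate_lt_or_eq hC hD hr0 (hrt.trans_le hu.1) huA.symm).resolve_right fun h => ?_
  exact hPr.ne' (h t ⟨hrt.le, hu.1⟩)

end Corridor

theorem mainTheorem2 (C : Corridor) (hC : C.IsValid) (D : RushHour) (hD : D.IsValid C) :
    -- the exit flow exists at all times and never exceeds the capacity of the downstream end
    (∀ t, 0 ≤ t →
      HasDerivWithinAt (fun r => C.cumulativeFlow D C.length r) (C.exitFlow D t) (Set.Ici t) t ∧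
      C.exitFlow D t ≤ C.exitCapacity) ∧
    -- the curve of accumulation against exit flow is counter-clockwise
    IsCounterclockwise (C.accumulation D) (C.exitFlow D) ∧
    -- during queuing the exit flow stays at bottleneck capacity
    (∀ t, 0 ≤ t → C.QueueActive D t → C.exitFlow D t = C.exitCapacity) ∧
    (C.saturatedTimes D).OrdConnected ∧
    -- if the end flow lets the queue dissolve, the curve consists of a rightward onset branch
    -- and a leftward offset branch
    (D.qe < C.exitCapacity →
      RisesThenFalls (C.accumulation D) ∧
      -- the period of exit flow at capacity ends with fewer vehicles than it began with
      BddAbove (C.saturatedTimes D) ∧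
      ((C.saturatedTimes D).Nontrivial →
        C.accumulation D (sSup (C.saturatedTimes D)) <
          C.accumulation D (sInf (C.saturatedTimes D))) ∧
      -- the loop is not degenerate once the rise of the exit flow meets a raised accumulation
      ((∃ t, 0 ≤ t ∧ C.accumulation D 0 < C.accumulation D t ∧
          C.exitFlow D 0 < C.exitFlow D t) →
        ∃ t₁ t₂, 0 ≤ t₁ ∧ t₁ < t₂ ∧ C.accumulation D t₁ = C.accumulation D t₂ ∧
          C.exitFlow D t₁ < C.exitFlow D t₂)) := by
  have hflow : ∀ {t}, 0 ≤ t → C.exitFlow D t = C.exitRate D t := Corridor.exitFlow_eq hC hD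
  refine ⟨fun t ht => ?_, Corridor.isCounterclockwise hC hD, fun t ht h => ?_,
    Corridor.ordConnected_saturatedTimes hC hD, fun hqe => ⟨Corridor.risesThenFalls hC hD hqe,
      Corridor.bddAbove_saturatedTimes hC hD hqe, Corridor.accumulation_sSup_lt hC hD hqe, ?_⟩⟩
  · rw [hflow ht]
    exact ⟨Corridor.exitCount_hasDeriv_cumulativeFlow hC hD ht,
      (Corridor.exitRate_mem hC hD ht).2⟩
  · rw [hflow ht]
    exact Corridor.exitRate_of_queueActive hC hD ht h
  · rintro ⟨t, ht, hA, hP⟩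
    rw [hflow le_rfl, hflow ht, Corridor.exitRate_zero hC hD] at hP
    obtain ⟨t₁, t₂, h1, h2, h3, h4⟩ : ∃ t₁ t₂, 0 ≤ t₁ ∧ t₁ < t₂ ∧
        C.accumulation D t₁ = C.accumulation D t₂ ∧ C.exitRate D t₁ < C.exitRate D t₂ := by
      rcases lt_or_ge D.qb D.qe with hbe | hbe
      · exact Corridor.exists_branches_of_qb_lt_qe hC hD hqe hbe
      · exact Corridor.exists_branches_of_qe_le_qb hC hD hqe hbe ht hA hP
    exact ⟨t₁, t₂, h1, h2, h3, by rwa [hflow h1, hflow (h1.trans h2.le)]⟩
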